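/- Let $\mathcal S\subseteq\{-1,0,1\}^2\setminus\{(0,0)\}$ be a set of small steps. Call $\mathcal S$ a (genuinely two-constraint quarter-plane) model if - $\mathcal S$ contains steps $(i,j)$ with $i>0$, with $i<0$, with $j>0$ and with $j<0$; - $\mathcal S$ contains a step $(i,j)$ with $i\ge 0$ and $j\ge 0$; - it is not true that every walk with steps in $\mathcal S$ starting at the origin and ending at a non-negative abscissa ends at a non-negative ordinate, and it is not true that every such walk ending at a non-negative ordinate ends at a non-negative abscissa. Two models are equivalent if they are equal or exchanged by the reflection $(i,j)\mapsto(j,i)$. Write $$\sum_{(i,j)\in\mathcal S}x^iy^j=A_{-1}(x)y^{-1}+A_0(x)+A_1(x)y=B_{-1}(y)x^{-1}+B_0(y)+B_1(y)x ,$$ and let $G(\mathcal S)$ be the group of birational transformations generated by the involutions $$\Phi:(x,y)\mapsto\Bigl(x^{-1}\frac{B_{-1}(y)}{B_1(y)},\,y\Bigr),\qquad \Psi:(x,y)\mapsto\Bigl(x,\,y^{-1}\frac{A_{-1}(x)}{A_1(x)}\Bigr).$$ Theorem. There are $79$ models up to equivalence. For exactly $23$ of these $79$ classes the group $G(\mathcal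 S)$ is finite, and for the other $56$ it is infinite (whichever representative of the class is taken). Among the $23$ finite classes: - exactly $16$ contain a model with a vertical symmetry, i.e. a model invariant under $(i,j)\mapsto(-i,j)$, and these are exactly the classes whose group has order $4$; - exactly $5$ have a group of order $6$; - exactly $2$ have a group of order $8$. -/

import Mathlib

/-- A (planar) step, or a point of the lattice `ℤ²`. -/
abbrev Step : Type := ℤ × ℤ

/-- The eight small steps: `{-1,0,1}² \ {(0,0)}`. -/
def smallSteps : Finset Step :=
  {(1, 0), (1, 1), (0, 1), (-1, 1), (-1, 0), (-1, -1), (0, -1), (1, -1)}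

theorem bounds_of_mem_smallSteps :
    ∀ s ∈ smallSteps, -1 ≤ s.1 ∧ s.1 ≤ 1 ∧ -1 ≤ s.2 ∧ s.2 ≤ 1 := by
  decide

/-- The `x`-condition forces the `y`-condition: every walk with steps in `S`, starting from the
origin, that ends at a non-negative abscissa ends at a non-negative ordinate. -/
def XForcesY (S : Finset Step) : Prop :=
  ∀ w : List Step, (∀ s ∈ w, s ∈ S) → 0 ≤ w.sum.1 → 0 ≤ w.sum.2

/-- The `y`-condition forces the `x`-condition. -/
def YForcesX (S : Finset Step) : Prop :=
  ∀ w : List Step, (∀ s ∈ w, s ∈ S) → 0 ≤ w.sum.2 → 0 ≤ w.sum.1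

/-- `S` contains `x`-positive, `x`-negative, `y`-positive and `y`-negative steps. -/
structure HasAllSigns (S : Finset Step) : Prop where
  x_pos : ∃ s ∈ S, 0 < s.1
  x_neg : ∃ s ∈ S, s.1 < 0
  y_pos : ∃ s ∈ S, 0 < s.2
  y_neg : ∃ s ∈ S, s.2 < 0

/-- The step sets of the genuinely two-constraint quarter-plane models with small steps. -/
structure IsModel (S : Finset Step) : Prop where
  small : S ⊆ smallSteps
  signs : HasAllSigns S
  /-- some step can be used from the origin, so that there are non-empty quarter-plane walks -/
  nonneg_step : ∃ s ∈ S, 0 ≤ s.1 ∧ 0 ≤ s.2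
  not_x_forces_y : ¬ XForcesY S
  not_y_forces_x : ¬ YForcesX S

/-- The type of genuinely two-constraint models. -/
def Model : Type := {S : Finset Step // IsModel S}

/-- The image of a step set under the reflection `(i,j) ↦ (j,i)` across the first diagonal. -/
def reflectDiag (S : Finset Step) : Finset Step := S.image Prod.swap

/-- `S` is invariant under the reflection `(i,j) ↦ (-i,j)` across a vertical line. -/
def VerticallySymmetric (S : Finset Step) : Prop :=
  S.image (fun s => (-s.1, s.2)) = S

theorem reflectDiag_reflectDiag (S : Finset Step) : reflectDiag (reflectDiag S) = S := by
  simp [reflectDiag, Finset.image_image]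

/-- Two models are equivalent if they are equal or differ by the `x/y` symmetry. -/
instance modelSetoid : Setoid Model where
  r M N := N.1 = M.1 ∨ N.1 = reflectDiag M.1
  iseqv :=
    { refl := fun _ => Or.inl rfl
      symm := by
        rintro M N (h | h)
        · exact Or.inl h.symm
        · right
          rw [h, reflectDiag_reflectDiag]
      trans := by
        rintro L M N (h | h) (h' | h')
        · exact Or.inl (h'.trans h)
        · right
          rw [h', h]
        · right
          rw [h', h]
        · left
          rw [h', h, reflectDiag_reflectDiag] }

/-- Models up to the `x/y` symmetry. -/
def ModelClass : Type := Quotient modelSetoid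

/-- The class of a model. -/
def Model.toClass (M : Model) : ModelClass := Quotient.mk modelSetoid M

namespace WalkGroup

/-- The field `ℚ(x,y)` of rational functions in two indeterminates. -/
abbrev RatXY : Type := FractionRing (MvPolynomial (Fin 2) ℚ)

/-- The indeterminate `x`. -/
noncomputable def X : RatXY := algebraMap (MvPolynomial (Fin 2) ℚ) RatXY (MvPolynomial.X 0)

/-- The indeterminate `y`. -/
noncomputable def Y : RatXY := algebraMap (MvPolynomial (Fin 2) ℚ) RatXY (MvPolynomial.X 1)

/-- `A_i(x)`, the coefficient of `y^i` in the step polynomial `∑_{(i,j) ∈ S} x^i y^j`. -/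
noncomputable def A (S : Finset Step) (i : ℤ) : RatXY := ∑ s ∈ S with s.2 = i, X ^ s.1

/-- `B_i(y)`, the coefficient of `x^i` in the step polynomial `∑_{(i,j) ∈ S} x^i y^j`. -/
noncomputable def B (S : Finset Step) (i : ℤ) : RatXY := ∑ s ∈ S with s.1 = i, Y ^ s.2

theorem X_ne_zero : X ≠ 0 := by
  simp [X]

theorem Y_ne_zero : Y ≠ 0 := by
  simp [Y]

/-- Evaluation at `1` shows that a non-empty sum of powers of an indeterminate is non-zero. -/
theorem sum_zpow_ne_zero (k : Fin 2) (T : Finset Step) (hT : T.Nonempty) (e : Step → ℤ)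
    (he : ∀ s ∈ T, -1 ≤ e s) :
    ∑ s ∈ T, (algebraMap (MvPolynomial (Fin 2) ℚ) RatXY (MvPolynomial.X k)) ^ e s ≠ 0 := by
  intro h
  have hX : algebraMap (MvPolynomial (Fin 2) ℚ) RatXY (MvPolynomial.X k) ≠ 0 := by simp
  have h1 : algebraMap (MvPolynomial (Fin 2) ℚ) RatXY
      (∑ s ∈ T, (MvPolynomial.X k) ^ (e s + 1).toNat) = 0 := by
    rw [map_sum]
    calc _ = ∑ s ∈ T, (algebraMap (MvPolynomial (Fin 2) ℚ) RatXY (MvPolynomial.X k)) ^ e s *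
          algebraMap (MvPolynomial (Fin 2) ℚ) RatXY (MvPolynomial.X k) := by
          refine Finset.sum_congr rfl fun s hs => ?_
          rw [map_pow, ← zpow_natCast, Int.toNat_of_nonneg (by linarith [he s hs]),
            zpow_add_one₀ hX]
      _ = 0 := by rw [← Finset.sum_mul, h, zero_mul]
  have h2 := (IsFractionRing.to_map_eq_zero_iff (K := RatXY)).1 h1
  have h3 := congrArg (MvPolynomial.eval fun _ => (1 : ℚ)) h2
  simp at h3
  exact hT.ne_empty h3

theorem A_ne_zero {S : Finset Step} (hS : S ⊆ smallSteps) {i : ℤ} (h : ∃ s ∈ S, s.2 = i) :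
    A S i ≠ 0 := by
  obtain ⟨s, hs, hi⟩ := h
  refine sum_zpow_ne_zero 0 _ ⟨s, by simp [hs, hi]⟩ _ fun t ht => ?_
  have := bounds_of_mem_smallSteps t (hS (Finset.mem_filter.1 ht).1)
  omega

theorem B_ne_zero {S : Finset Step} (hS : S ⊆ smallSteps) {i : ℤ} (h : ∃ s ∈ S, s.1 = i) :
    B S i ≠ 0 := by
  obtain ⟨s, hs, hi⟩ := h
  refine sum_zpow_ne_zero 1 _ ⟨s, by simp [hs, hi]⟩ _ fun t ht => ?_
  have := bounds_of_mem_smallSteps t (hS (Finset.mem_filter.1 ht).1)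
  omega

theorem adjoin_XY : IntermediateField.adjoin ℚ {X, Y} = ⊤ := by
  rw [eq_top_iff]
  intro z _
  have key : ∀ p : MvPolynomial (Fin 2) ℚ,
      algebraMap _ RatXY p ∈ IntermediateField.adjoin ℚ {X, Y} := by
    intro p
    induction p using MvPolynomial.induction_on with
    | C a =>
      have : algebraMap (MvPolynomial (Fin 2) ℚ) RatXY (MvPolynomial.C a) = algebraMap ℚ RatXY a :=
        (IsScalarTower.algebraMap_apply ℚ (MvPolynomial (Fin 2) ℚ) RatXY a).symm
      rw [this]
      exact IntermediateField.algebraMap_mem _ _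
    | add p q hp hq => rw [map_add]; exact add_mem hp hq
    | mul_X p k hp =>
      rw [map_mul]
      refine mul_mem hp (IntermediateField.subset_adjoin _ _ ?_)
      fin_cases k
      · exact Or.inl rfl
      · exact Or.inr rfl
  obtain ⟨p, q, -, rfl⟩ := IsFractionRing.div_surjective (MvPolynomial (Fin 2) ℚ) z
  exact div_mem (key p) (key q)

/-- Two rational functions that generate `ℚ(x,y)` are algebraically independent. -/
theorem algebraicIndependent_of_mem (a b : RatXY)
    (hX : X ∈ IntermediateField.adjoin ℚ {a, b}) (hY : Y ∈ IntermediateField.adjoin ℚ {a, b}) :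
    AlgebraicIndependent ℚ ![a, b] := by
  have htop : IntermediateField.adjoin ℚ {a, b} = ⊤ := by
    rw [eq_top_iff, ← adjoin_XY, IntermediateField.adjoin_le_iff]
    rintro z (rfl | rfl)
    · exact hX
    · exact hY
  have hr : Set.range ![a, b] = {a, b} := by
    simp [Matrix.range_cons, Set.pair_comm]
  have halg : Algebra.IsAlgebraic (Algebra.adjoin ℚ (Set.range ![a, b])) RatXY := by
    refine ⟨fun z => ?_⟩
    have hz : z ∈ IntermediateField.adjoin ℚ (Set.range ![a, b]) := by
      rw [hr, htop]; trivial
    obtain ⟨r, hr, s, hs, rfl⟩ := IntermediateField.mem_adjoin_iff_div.1 hz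
    rw [div_eq_mul_inv]
    exact (isAlgebraic_algebraMap (⟨r, hr⟩ : Algebra.adjoin ℚ (Set.range ![a, b]))).mul
      (isAlgebraic_algebraMap (⟨s, hs⟩ : Algebra.adjoin ℚ (Set.range ![a, b]))).inv
  have hd : Algebra.trdeg ℚ RatXY = 2 := by
    have : Algebra.IsAlgebraic (MvPolynomial (Fin 2) ℚ) RatXY :=
      IsLocalization.isAlgebraic _
        (nonZeroDivisors (MvPolynomial (Fin 2) ℚ))
    have h := (IsTranscendenceBasis.mvPolynomial (Fin 2) ℚ).algebraMap_comp (A := RatXY)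
    have := h.cardinalMk_eq_trdeg
    simpa using this.symm
  refine (Algebra.IsAlgebraic.isTranscendenceBasis_of_le_trdeg_of_finite (R := ℚ) ![a, b] ?_).1
  simp [hd]

/-- Substitution `f(x,y) ↦ f(a,b)`, for algebraically independent `a, b`. -/
noncomputable def subst (a b : RatXY) (h : AlgebraicIndependent ℚ ![a, b]) : RatXY →ₐ[ℚ] RatXY :=
  IsFractionRing.liftAlgHom (g := MvPolynomial.aeval ![a, b])
    (algebraicIndependent_iff_injective_aeval.1 h)

theorem subst_X (a b : RatXY) (h : AlgebraicIndependent ℚ ![a, b]) : subst a b h X = a := by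
  rw [subst, X, IsFractionRing.liftAlgHom_apply, IsFractionRing.lift_algebraMap]
  simp

theorem subst_Y (a b : RatXY) (h : AlgebraicIndependent ℚ ![a, b]) : subst a b h Y = b := by
  rw [subst, Y, IsFractionRing.liftAlgHom_apply, IsFractionRing.lift_algebraMap]
  simp

theorem algHom_ext {f g : RatXY →ₐ[ℚ] RatXY} (hX : f X = g X) (hY : f Y = g Y) : f = g := by
  refine IsLocalization.algHom_ext (nonZeroDivisors (MvPolynomial (Fin 2) ℚ)) ?_
  refine MvPolynomial.algHom_ext fun k => ?_
  fin_cases k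
  · exact hX
  · exact hY

/-- A substitution that is an involution on `x` and `y` is an automorphism of `ℚ(x,y)`. -/
noncomputable def substEquiv (a b : RatXY) (h : AlgebraicIndependent ℚ ![a, b])
    (ha : subst a b h a = X) (hb : subst a b h b = Y) : RatXY ≃ₐ[ℚ] RatXY :=
  AlgEquiv.ofAlgHom (subst a b h) (subst a b h)
    (algHom_ext (by simp [subst_X, ha]) (by simp [subst_Y, hb]))
    (algHom_ext (by simp [subst_X, ha]) (by simp [subst_Y, hb]))

end WalkGroup

namespace Model

open WalkGroup

theorem A_ne_zero (M : Model) : A M.1 1 ≠ 0 ∧ A M.1 (-1) ≠ 0 := by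
  obtain ⟨s, hs, h⟩ := M.2.signs.y_pos
  obtain ⟨t, ht, h'⟩ := M.2.signs.y_neg
  have h1 := bounds_of_mem_smallSteps s (M.2.small hs)
  have h2 := bounds_of_mem_smallSteps t (M.2.small ht)
  exact ⟨WalkGroup.A_ne_zero M.2.small ⟨s, hs, by omega⟩,
    WalkGroup.A_ne_zero M.2.small ⟨t, ht, by omega⟩⟩

theorem B_ne_zero (M : Model) : B M.1 1 ≠ 0 ∧ B M.1 (-1) ≠ 0 := by
  obtain ⟨s, hs, h⟩ := M.2.signs.x_pos
  obtain ⟨t, ht, h'⟩ := M.2.signs.x_neg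
  have h1 := bounds_of_mem_smallSteps s (M.2.small hs)
  have h2 := bounds_of_mem_smallSteps t (M.2.small ht)
  exact ⟨WalkGroup.B_ne_zero M.2.small ⟨s, hs, by omega⟩,
    WalkGroup.B_ne_zero M.2.small ⟨t, ht, by omega⟩⟩

theorem algebraicIndependent_phi (M : Model) :
    AlgebraicIndependent ℚ ![X⁻¹ * (B M.1 (-1) / B M.1 1), Y] := by
  set a := X⁻¹ * (B M.1 (-1) / B M.1 1) with ha
  have hY : Y ∈ IntermediateField.adjoin ℚ {a, Y} :=
    IntermediateField.subset_adjoin _ _ (Or.inr rfl)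
  have hB : ∀ i, B M.1 i ∈ IntermediateField.adjoin ℚ {a, Y} :=
    fun i => sum_mem fun s _ => zpow_mem hY _
  refine algebraicIndependent_of_mem _ _ ?_ hY
  have hX : X = B M.1 (-1) / B M.1 1 / a := by
    have := X_ne_zero
    have := M.B_ne_zero.1
    have := M.B_ne_zero.2
    rw [ha]
    field_simp
  rw [hX]
  exact div_mem (div_mem (hB _) (hB _)) (IntermediateField.subset_adjoin _ _ (Or.inl rfl))

theorem algebraicIndependent_psi (M : Model) :
    AlgebraicIndependent ℚ ![X, Y⁻¹ * (A M.1 (-1) / A M.1 1)] := by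
  set a := Y⁻¹ * (A M.1 (-1) / A M.1 1) with ha
  have hX : X ∈ IntermediateField.adjoin ℚ {X, a} :=
    IntermediateField.subset_adjoin _ _ (Or.inl rfl)
  have hA : ∀ i, A M.1 i ∈ IntermediateField.adjoin ℚ {X, a} :=
    fun i => sum_mem fun s _ => zpow_mem hX _
  refine algebraicIndependent_of_mem _ _ hX ?_
  have hY : Y = A M.1 (-1) / A M.1 1 / a := by
    have := Y_ne_zero
    have := M.A_ne_zero.1
    have := M.A_ne_zero.2
    rw [ha]
    field_simp
  rw [hY]
  exact div_mem (div_mem (hA _) (hA _)) (IntermediateField.subset_adjoin _ _ (Or.inr rfl))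

/-- The involution `Φ : (x,y) ↦ (x⁻¹ B₋₁(y) / B₁(y), y)`, as the automorphism `f ↦ f ∘ Φ` of
`ℚ(x,y)`. -/
noncomputable def phi (M : Model) : RatXY ≃ₐ[ℚ] RatXY :=
  substEquiv (X⁻¹ * (B M.1 (-1) / B M.1 1)) Y M.algebraicIndependent_phi
    (by
      have := X_ne_zero
      have := M.B_ne_zero.1
      have := M.B_ne_zero.2
      have h : ∀ i, subst _ Y M.algebraicIndependent_phi (B M.1 i) = B M.1 i := fun i => by
        simp [B, subst_Y]
      rw [map_mul, map_div₀, map_inv₀, h, h, subst_X]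
      field_simp)
    (subst_Y _ _ _)

/-- The involution `Ψ : (x,y) ↦ (x, y⁻¹ A₋₁(x) / A₁(x))`, as the automorphism `f ↦ f ∘ Ψ` of
`ℚ(x,y)`. -/
noncomputable def psi (M : Model) : RatXY ≃ₐ[ℚ] RatXY :=
  substEquiv X (Y⁻¹ * (A M.1 (-1) / A M.1 1)) M.algebraicIndependent_psi
    (subst_X _ _ _)
    (by
      have := Y_ne_zero
      have := M.A_ne_zero.1
      have := M.A_ne_zero.2
      have h : ∀ i, subst X _ M.algebraicIndependent_psi (A M.1 i) = A M.1 i := fun i => by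
        simp [A, subst_X]
      rw [map_mul, map_div₀, map_inv₀, h, h, subst_Y]
      field_simp)

theorem phi_X (M : Model) : M.phi X = X⁻¹ * (B M.1 (-1) / B M.1 1) :=
  subst_X _ _ M.algebraicIndependent_phi

theorem phi_Y (M : Model) : M.phi Y = Y := subst_Y _ _ M.algebraicIndependent_phi

theorem psi_X (M : Model) : M.psi X = X := subst_X _ _ M.algebraicIndependent_psi

theorem psi_Y (M : Model) : M.psi Y = Y⁻¹ * (A M.1 (-1) / A M.1 1) :=
  subst_Y _ _ M.algebraicIndependent_psi

/-- The group `G(S)` generated by `Φ` and `Ψ`. A birational transformation `g` of the plane is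
identified with the automorphism `f ↦ f ∘ g` of the function field; this reverses products, so
that the group generated by `Φ` and `Ψ` becomes the (isomorphic) opposite group. -/
noncomputable def group (M : Model) : Subgroup (RatXY ≃ₐ[ℚ] RatXY) :=
  Subgroup.closure {M.phi, M.psi}

end Model

/-! `Φ` and `Ψ` are non-trivial involutions, so they generate a dihedral group of order twice the
order of `ΦΨ` (`Subgroup.card_closure_pair_of_involutions`). Everything reduces to finding the order
of `ΦΨ` for finitely many step sets.

Finite orders. An axis symmetry makes `Φ` and `Ψ` commute. In the other finite cases both maps are
monomial, so the order is that of an action on exponents.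

Infinite orders. Order the exponents of `x` and `y` lexicographically. Leading exponents of the
iterates of `(x,y)` then follow a piecewise linear map `tropTheta`. If this map returns to the start
after `m` steps, `(ΦΨ)^m` fixes the leading monomials of `x` and `y`. An automorphism of this kind
is unipotent in characteristic zero, so it is trivial or of infinite order (`eq_one_of_pow_eq_one`).
It is non-trivial as soon as `(ΦΨ)^m` moves the rational point `(2,3)`. For the singular models the
leading exponents grow linearly instead, which rules out finite order directly.

Being a model is a decidable condition on the steps (`isModel_iff`), so matching each model to one
of these cases and counting canonical representatives are finite computations over subsets of eight
steps. -/

namespace WalkGroup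

/-! ### The lexicographic valuation on `ℚ(x,y)` -/

open HahnSeries

/-- The lexicographically ordered group of exponents. -/
abbrev LexExp : Type := ℤ ×ₗ ℤ

/-- The embedding of `ℚ[x,y]` into the Hahn series with lexicographically ordered exponents. -/
noncomputable def toHahn : MvPolynomial (Fin 2) ℚ →+* HahnSeries LexExp ℚ :=
  MvPolynomial.eval₂Hom (HahnSeries.C) ![single (toLex (1, 0)) 1, single (toLex (0, 1)) 1]

theorem toHahn_monomial (m : Fin 2 →₀ ℕ) (c : ℚ) :
    toHahn (MvPolynomial.monomial m c) = single (toLex ((m 0 : ℤ), (m 1 : ℤ))) c := by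
  have h : ∀ (g : LexExp) (n : ℕ), (single g (1 : ℚ)) ^ n = single (n • g) 1 := fun g n => by
    rw [single_pow, one_pow]
  simp only [toHahn, MvPolynomial.coe_eval₂Hom, MvPolynomial.eval₂_monomial]
  rw [Finsupp.prod_fintype _ _ (by simp), Fin.prod_univ_two]
  simp only [Matrix.cons_val_zero, Matrix.cons_val_one, h, single_mul_single]
  rw [C_apply, single_mul_single]
  congr 1
  · rw [zero_add]
    refine congrArg _ ?_
    change toLex (m 0 • ((1 : ℤ), (0 : ℤ)) + m 1 • ((0 : ℤ), (1 : ℤ))) = _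
    simp
  · simp

theorem coeff_toHahn (p : MvPolynomial (Fin 2) ℚ) (m : Fin 2 →₀ ℕ) :
    (toHahn p).coeff (toLex ((m 0 : ℤ), (m 1 : ℤ))) = p.coeff m := by
  induction p using MvPolynomial.induction_on' with
  | monomial n c =>
    rw [toHahn_monomial, coeff_single, MvPolynomial.coeff_monomial]
    congr 1
    simp only [EmbeddingLike.apply_eq_iff_eq, Prod.mk.injEq, Nat.cast_inj, eq_iff_iff]
    constructor
    · rintro ⟨h0, h1⟩
      ext i
      fin_cases i
      · exact h0.symm
      · exact h1.symm
    · rintro rfl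
      simp
  | add p q hp hq => rw [map_add, coeff_add, hp, hq, MvPolynomial.coeff_add]

theorem toHahn_injective : Function.Injective toHahn := by
  rw [injective_iff_map_eq_zero]
  intro p hp
  ext m
  rw [← coeff_toHahn, hp]
  simp

/-- The lexicographic order of vanishing of a rational function at the origin. -/
noncomputable def ord : AddValuation RatXY (WithTop LexExp) :=
  (addVal LexExp ℚ).comap (IsFractionRing.lift toHahn_injective)

theorem ord_algebraMap (p : MvPolynomial (Fin 2) ℚ) :
    ord (algebraMap _ RatXY p) = (toHahn p).orderTop := by
  change addVal LexExp ℚ (IsFractionRing.lift toHahn_injective _) = _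
  rw [IsFractionRing.lift_algebraMap, addVal_apply]

theorem ord_X : ord X = ((toLex (1, 0) : LexExp) : WithTop LexExp) := by
  rw [X, ord_algebraMap]
  simp [toHahn]

theorem ord_Y : ord Y = ((toLex (0, 1) : LexExp) : WithTop LexExp) := by
  rw [Y, ord_algebraMap]
  simp [toHahn]

theorem ord_algebraMap_le (p : MvPolynomial (Fin 2) ℚ) {m : Fin 2 →₀ ℕ} (hm : m ∈ p.support) :
    ord (algebraMap _ RatXY p) ≤ ((toLex ((m 0 : ℤ), (m 1 : ℤ)) : LexExp) : WithTop LexExp) := by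
  rw [ord_algebraMap]
  refine orderTop_le_of_coeff_ne_zero ?_
  rw [coeff_toHahn]
  exact MvPolynomial.mem_support_iff.1 hm

end WalkGroup

/-! ### One-units and leading monomials -/

/-- The one-units of an additive valuation. -/
def AddValuation.IsOneUnit {K Γ : Type*} [Field K] [AddCommGroup Γ] [LinearOrder Γ]
    [IsOrderedAddMonoid Γ] (v : AddValuation K (WithTop Γ)) (u : K) : Prop :=
  0 < v (u - 1)

namespace AddValuation

variable {K Γ : Type*} [Field K] [AddCommGroup Γ] [LinearOrder Γ] [IsOrderedAddMonoid Γ]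
  {v : AddValuation K (WithTop Γ)} {a b : K}

theorem IsOneUnit.one : v.IsOneUnit 1 := by
  simp [IsOneUnit]

theorem IsOneUnit.val_eq (ha : v.IsOneUnit a) : v a = 0 := by
  have := v.map_eq_of_lt_sub (x := 1) (y := a) (by rw [v.map_one]; exact ha)
  simpa using this

theorem IsOneUnit.ne_zero (ha : v.IsOneUnit a) : a ≠ 0 := by
  rintro rfl
  simpa using ha.val_eq

theorem IsOneUnit.mul (ha : v.IsOneUnit a) (hb : v.IsOneUnit b) : v.IsOneUnit (a * b) := by
  have h : a * b - 1 = (a - 1) * b + (b - 1) := by ring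
  unfold IsOneUnit
  rw [h]
  refine v.map_lt_add ?_ hb
  rw [v.map_mul, hb.val_eq, add_zero]
  exact ha

theorem IsOneUnit.inv (ha : v.IsOneUnit a) : v.IsOneUnit a⁻¹ := by
  have := ha.ne_zero
  have h : a⁻¹ - 1 = -(a - 1) * a⁻¹ := by field_simp; ring
  have h' : v a⁻¹ = 0 := by
    have := v.map_mul a a⁻¹
    rw [mul_inv_cancel₀ ha.ne_zero, ha.val_eq, zero_add, v.map_one] at this
    exact this.symm
  unfold IsOneUnit
  rw [h, v.map_mul, v.map_neg, h', add_zero]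
  exact ha

theorem IsOneUnit.one_add (ha : 0 < v a) : v.IsOneUnit (1 + a) := by
  simpa [IsOneUnit] using ha

end AddValuation

namespace WalkGroup

/-- The monomial with exponent `e`. -/
noncomputable def mon (e : Step) : RatXY := X ^ e.1 * Y ^ e.2

theorem mon_ne_zero (e : Step) : mon e ≠ 0 :=
  mul_ne_zero (zpow_ne_zero _ X_ne_zero) (zpow_ne_zero _ Y_ne_zero)

theorem mon_add (e f : Step) : mon (e + f) = mon e * mon f := by
  simp only [mon, Prod.fst_add, Prod.snd_add, zpow_add₀ X_ne_zero, zpow_add₀ Y_ne_zero]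
  ring

theorem mon_zero : mon 0 = 1 := by simp [mon]

theorem mon_neg (e : Step) : mon (-e) = (mon e)⁻¹ := by
  refine eq_inv_of_mul_eq_one_left ?_
  rw [← mon_add, neg_add_cancel, mon_zero]

theorem ord_zpow {f : RatXY} {g : LexExp} (h : ord f = (g : WithTop LexExp)) (n : ℤ) :
    ord (f ^ n) = ((n • g : LexExp) : WithTop LexExp) := by
  have hf : f ≠ 0 := by
    rintro rfl
    simp at h
  have hN : ∀ n : ℕ, ord (f ^ n) = ((n • g : LexExp) : WithTop LexExp) := fun n => by
    rw [ord.map_pow, h, WithTop.coe_nsmul]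
  obtain ⟨n, rfl | rfl⟩ := n.eq_nat_or_neg
  · simpa using hN n
  · have h1 := ord.map_mul (f ^ n) (f ^ (-(n : ℤ)))
    rw [zpow_neg, zpow_natCast, mul_inv_cancel₀ (pow_ne_zero _ hf), hN, ord.map_one] at h1
    rw [zpow_neg, zpow_natCast]
    generalize ord (f ^ n)⁻¹ = z at *
    cases z with
    | top => simp at h1
    | coe z =>
      rw [← WithTop.coe_add, ← WithTop.coe_zero, WithTop.coe_inj] at h1
      rw [WithTop.coe_inj, neg_smul, natCast_zsmul]
      exact (neg_eq_of_add_eq_zero_right h1.symm).symm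

theorem ord_mon (e : Step) : ord (mon e) = ((toLex e : LexExp) : WithTop LexExp) := by
  rw [mon, ord.map_mul, ord_zpow ord_X, ord_zpow ord_Y, ← WithTop.coe_add, WithTop.coe_inj]
  change toLex (e.1 • ((1 : ℤ), (0 : ℤ)) + e.2 • ((0 : ℤ), (1 : ℤ))) = _
  simp

/-- `f` is the monomial with exponent `e` plus terms of higher order. -/
def HasLead (f : RatXY) (e : Step) : Prop := ord.IsOneUnit (f / mon e)

variable {f g : RatXY} {d e : Step}

theorem HasLead.mon (e : Step) : HasLead (mon e) e := by
  rw [HasLead, div_self (mon_ne_zero e)]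
  exact .one

theorem HasLead.X : HasLead X (1, 0) := by
  simpa [WalkGroup.mon] using HasLead.mon (1, 0)

theorem HasLead.Y : HasLead Y (0, 1) := by
  simpa [WalkGroup.mon] using HasLead.mon (0, 1)

theorem HasLead.one : HasLead 1 0 := by
  simpa [mon_zero] using HasLead.mon 0

theorem HasLead.mul (hf : HasLead f d) (hg : HasLead g e) : HasLead (f * g) (d + e) := by
  rw [HasLead, mon_add, mul_div_mul_comm]
  exact AddValuation.IsOneUnit.mul hf hg

theorem HasLead.inv (hf : HasLead f e) : HasLead f⁻¹ (-e) := by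
  rw [HasLead, mon_neg, inv_div_inv, ← inv_div]
  exact AddValuation.IsOneUnit.inv hf

theorem HasLead.div (hf : HasLead f d) (hg : HasLead g e) : HasLead (f / g) (d - e) := by
  rw [div_eq_mul_inv, sub_eq_add_neg]
  exact hf.mul hg.inv

theorem HasLead.pow (hf : HasLead f e) (n : ℕ) : HasLead (f ^ n) (n • e) := by
  induction n with
  | zero => simpa using HasLead.one
  | succ n ih => rw [pow_succ, succ_nsmul]; exact ih.mul hf

theorem HasLead.ord_eq (hf : HasLead f e) : ord f = ((toLex e : LexExp) : WithTop LexExp) := by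
  rw [← ord_mon, ← div_mul_cancel₀ f (mon_ne_zero e), ord.map_mul,
    AddValuation.IsOneUnit.val_eq hf, zero_add]

theorem HasLead.unique (hf : HasLead f d) (hf' : HasLead f e) : d = e := by
  have := hf.ord_eq.symm.trans hf'.ord_eq
  simpa using this

theorem HasLead.lt_ord_sub (hf : HasLead f e) :
    ((toLex e : LexExp) : WithTop LexExp) < ord (f - WalkGroup.mon e) := by
  have h : f - WalkGroup.mon e = (f / WalkGroup.mon e - 1) * WalkGroup.mon e := by
    have := mon_ne_zero e
    field_simp
  have h1 : 0 < ord (f / WalkGroup.mon e - 1) := hf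
  rw [h, ord.map_mul, ord_mon]
  generalize ord (f / WalkGroup.mon e - 1) = z at *
  cases z with
  | top => simp
  | coe z =>
    rw [← WithTop.coe_add, WithTop.coe_lt_coe]
    exact lt_add_of_pos_left _ (by exact_mod_cast h1)

end WalkGroup

/-! ### Automorphisms preserving leading monomials -/

namespace WalkGroup

theorem ord_ratCast {c : ℚ} (hc : c ≠ 0) : ord (algebraMap ℚ RatXY c) = 0 := by
  rw [IsScalarTower.algebraMap_apply ℚ (MvPolynomial (Fin 2) ℚ) RatXY, ord_algebraMap,
    MvPolynomial.algebraMap_eq, ← MvPolynomial.monomial_zero', toHahn_monomial]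
  exact HahnSeries.orderTop_single hc

theorem algebraMap_monomial (m : Fin 2 →₀ ℕ) (c : ℚ) :
    algebraMap _ RatXY (MvPolynomial.monomial m c) =
      algebraMap ℚ RatXY c * (X ^ m 0 * Y ^ m 1) := by
  rw [MvPolynomial.monomial_eq, map_mul, Finsupp.prod_fintype _ _ (by simp), Fin.prod_univ_two,
    map_mul, map_pow, map_pow, IsScalarTower.algebraMap_apply ℚ (MvPolynomial (Fin 2) ℚ) RatXY]
  rfl

section TrivialOnLeads

variable {σ : RatXY ≃ₐ[ℚ] RatXY} (hX : HasLead (σ X) (1, 0)) (hY : HasLead (σ Y) (0, 1))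

theorem nonneg_ord_natCast (n : ℕ) : 0 ≤ ord (n : RatXY) := by
  rcases eq_or_ne n 0 with rfl | hn
  · simp
  · have := ord_ratCast (c := n) (by exact_mod_cast hn)
    simp only [map_natCast] at this
    exact this.ge

include hX hY

theorem lt_ord_algEquiv_sub_monomial (m : Fin 2 →₀ ℕ) {c : ℚ} (hc : c ≠ 0) :
    ((toLex ((m 0 : ℤ), (m 1 : ℤ)) : LexExp) : WithTop LexExp) <
      ord (σ (algebraMap _ RatXY (MvPolynomial.monomial m c)) -
        algebraMap _ RatXY (MvPolynomial.monomial m c)) := by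
  have h := ((hX.pow (m 0)).mul (hY.pow (m 1))).lt_ord_sub
  have he : m 0 • ((1, 0) : Step) + m 1 • ((0, 1) : Step) = ((m 0 : ℤ), (m 1 : ℤ)) := by simp
  rw [he] at h
  rw [algebraMap_monomial, map_mul, map_mul, map_pow, map_pow, σ.commutes, ← mul_sub, ord.map_mul,
    ord_ratCast hc, zero_add]
  simpa [mon] using h

/-- Each monomial of `p` is changed by `σ` only by terms of order strictly above its own, hence
strictly above the order of `p`. Summing over the support preserves this bound. -/
theorem isOneUnit_algEquiv_algebraMap {p : MvPolynomial (Fin 2) ℚ} (hp : p ≠ 0) :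
    ord.IsOneUnit (σ (algebraMap _ RatXY p) / algebraMap _ RatXY p) := by
  have hp' : algebraMap _ RatXY p ≠ 0 := by simpa using hp
  have key : ord (algebraMap _ RatXY p) <
      ord (σ (algebraMap _ RatXY p) - algebraMap _ RatXY p) := by
    have hs : σ (algebraMap _ RatXY p) - algebraMap _ RatXY p = ∑ m ∈ p.support,
        (σ (algebraMap _ RatXY (MvPolynomial.monomial m (p.coeff m))) -
          algebraMap _ RatXY (MvPolynomial.monomial m (p.coeff m))) := by
      conv_lhs => rw [p.as_sum]
      simp only [map_sum, Finset.sum_sub_distrib]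
    rw [hs]
    refine ord.map_lt_sum ?_ fun m hm => ?_
    · rwa [AddValuation.ne_top_iff]
    · exact (ord_algebraMap_le p hm).trans_lt
        (lt_ord_algEquiv_sub_monomial hX hY m (MvPolynomial.mem_support_iff.1 hm))
  have h : σ (algebraMap _ RatXY p) - algebraMap _ RatXY p =
      (σ (algebraMap _ RatXY p) / algebraMap _ RatXY p - 1) * algebraMap _ RatXY p := by
    field_simp
  rw [h, ord.map_mul] at key
  unfold AddValuation.IsOneUnit
  by_contra! h0
  exact absurd key (not_lt.2 (by simpa using add_le_add_left h0 (ord (algebraMap _ RatXY p))))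

theorem isOneUnit_algEquiv {f : RatXY} (hf : f ≠ 0) : ord.IsOneUnit (σ f / f) := by
  obtain ⟨p, q, hq, rfl⟩ := IsFractionRing.div_surjective (MvPolynomial (Fin 2) ℚ) f
  have hp : p ≠ 0 := by
    rintro rfl
    simp at hf
  rw [map_div₀, div_div_div_comm, div_eq_mul_inv]
  exact (isOneUnit_algEquiv_algebraMap hX hY hp).mul
    (isOneUnit_algEquiv_algebraMap hX hY (nonZeroDivisors.ne_zero hq)).inv

theorem ord_algEquiv (f : RatXY) : ord (σ f) = ord f := by
  rcases eq_or_ne f 0 with rfl | hf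
  · simp
  · rw [← div_mul_cancel₀ (σ f) hf, ord.map_mul, (isOneUnit_algEquiv hX hY hf).val_eq, zero_add]

/-- An automorphism of finite order of `ℚ(x,y)` that preserves leading monomials is trivial. -/
theorem eq_one_of_pow_eq_one {n : ℕ} (hn : 0 < n) (h : σ ^ n = 1) : σ = 1 := by
  by_contra hσ
  obtain ⟨f, hf⟩ : ∃ f, σ f ≠ f := by
    by_contra! h'
    exact hσ (AlgEquiv.ext h')
  have hd : σ f - f ≠ 0 := sub_ne_zero.2 hf
  set d := σ f - f with hd_def
  -- Modulo terms of positive order, `σ` fixes `d` up to a one-unit, so each application of `σ` adds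
  -- one more copy of `d` to the displacement of `f`.
  have key : ∀ n : ℕ, 0 < ord (((σ ^ n) f - f) / d - n) := by
    intro n
    induction n with
    | zero => simp
    | succ n ih =>
      set r := ((σ ^ n) f - f) / d - n with hr
      have hu : 0 < ord (σ d / d - 1) := isOneUnit_algEquiv hX hY hd
      have h1 : ((σ ^ (n + 1)) f - f) / d - ((n + 1 : ℕ) : RatXY) =
          σ r * (σ d / d) + n * (σ d / d - 1) := by
        have h2 : (σ ^ n) f = (r + n) * d + f := by
          rw [hr]
          field_simp
          ring
        have h3 : σ f = d + f := by rw [hd_def]; ring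
        rw [pow_succ', AlgEquiv.mul_apply, h2, map_add, map_mul, map_add, map_natCast, h3]
        push_cast
        field_simp
        ring
      rw [h1]
      refine ord.map_lt_add ?_ ?_
      · rw [ord.map_mul, ord_algEquiv hX hY, (isOneUnit_algEquiv hX hY hd).val_eq, add_zero]
        exact ih
      · rw [ord.map_mul]
        exact hu.trans_le (le_add_of_nonneg_left (nonneg_ord_natCast n))
  -- When `σ ^ n = 1` the displacement vanishes, so `-n` would have positive order, but non-zero
  -- rational constants have order `0`.
  have := key n
  rw [h] at this
  simp only [AlgEquiv.one_apply, sub_self, zero_div, zero_sub, ord.map_neg] at this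
  have h0 := ord_ratCast (c := n) (by exact_mod_cast hn.ne')
  simp only [map_natCast] at h0
  exact this.ne' h0

end TrivialOnLeads

end WalkGroup

/-! ### The two involutions as maps on pairs of field elements -/

/-- The sum of the powers `b ^ j`, for the `j ∈ {-1, 0, 1}` with `p j`. -/
def lineSum {F : Type*} [Field F] (p : ℤ → Bool) (b : F) : F :=
  (if p (-1) then b⁻¹ else 0) + (if p 0 then 1 else 0) + (if p 1 then b else 0)

/-- The indicator of the steps with abscissa `i`. -/
def col (S : Finset Step) (i : ℤ) : ℤ → Bool := fun j => decide ((i, j) ∈ S)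

/-- The indicator of the steps with ordinate `j`. -/
def row (S : Finset Step) (j : ℤ) : ℤ → Bool := fun i => decide ((i, j) ∈ S)

/-- The involution `Φ` on pairs of elements of a field. -/
def phiMap {F : Type*} [Field F] (S : Finset Step) (P : F × F) : F × F :=
  (P.1⁻¹ * (lineSum (col S (-1)) P.2 / lineSum (col S 1) P.2), P.2)

/-- The involution `Ψ` on pairs of elements of a field. -/
def psiMap {F : Type*} [Field F] (S : Finset Step) (P : F × F) : F × F :=
  (P.1, P.2⁻¹ * (lineSum (row S (-1)) P.1 / lineSum (row S 1) P.1))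

/-- The composition `Ψ ∘ Φ`. -/
def thetaMap {F : Type*} [Field F] (S : Finset Step) (P : F × F) : F × F := psiMap S (phiMap S P)

/-- A line of steps is non-empty. -/
def LineNonempty (p : ℤ → Bool) : Prop := p (-1) ∨ p 0 ∨ p 1

namespace WalkGroup

theorem B_eq_lineSum {S : Finset Step} (hS : S ⊆ smallSteps) (i : ℤ) :
    B S i = lineSum (col S i) Y := by
  have h : S.filter (fun s => s.1 = i) =
      (({-1, 0, 1} : Finset ℤ).filter fun j => (i, j) ∈ S).image fun j => (i, j) := by
    ext ⟨a, b⟩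
    simp only [Finset.mem_filter, Finset.mem_image, Prod.mk.injEq, Finset.mem_insert,
      Finset.mem_singleton]
    constructor
    · rintro ⟨h, rfl⟩
      have := bounds_of_mem_smallSteps _ (hS h)
      simp only at this
      exact ⟨b, ⟨by omega, h⟩, rfl, rfl⟩
    · rintro ⟨c, ⟨-, h⟩, rfl, rfl⟩
      exact ⟨h, rfl⟩
  rw [B, h, Finset.sum_image (by simp), Finset.sum_filter]
  simp [lineSum, col, add_assoc]

theorem A_eq_lineSum {S : Finset Step} (hS : S ⊆ smallSteps) (j : ℤ) :
    A S j = lineSum (row S j) X := by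
  have h : S.filter (fun s => s.2 = j) =
      (({-1, 0, 1} : Finset ℤ).filter fun i => (i, j) ∈ S).image fun i => (i, j) := by
    ext ⟨a, b⟩
    simp only [Finset.mem_filter, Finset.mem_image, Prod.mk.injEq, Finset.mem_insert,
      Finset.mem_singleton]
    constructor
    · rintro ⟨h, rfl⟩
      have := bounds_of_mem_smallSteps _ (hS h)
      simp only at this
      exact ⟨a, ⟨by omega, h⟩, rfl, rfl⟩
    · rintro ⟨c, ⟨-, h⟩, rfl, rfl⟩
      exact ⟨h, rfl⟩
  rw [A, h, Finset.sum_image (by simp), Finset.sum_filter]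
  simp [lineSum, row, add_assoc]

theorem map_lineSum {F G : Type*} [Field F] [Field G] {H : Type*} [FunLike H F G]
    [RingHomClass H F G] (g : H) (p : ℤ → Bool) (b : F) :
    g (lineSum p b) = lineSum p (g b) := by
  simp only [lineSum, map_add, apply_ite g, map_inv₀, map_one, map_zero]

/-- The images of the two indeterminates. -/
noncomputable def image (g : RatXY ≃ₐ[ℚ] RatXY) : RatXY × RatXY := (g X, g Y)

theorem image_one : image 1 = (X, Y) := rfl

theorem image_injective : Function.Injective image := by
  intro f g h
  have h' := Prod.mk.inj h
  have : f.toAlgHom = g.toAlgHom := algHom_ext h'.1 h'.2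
  exact AlgEquiv.ext fun x => DFunLike.congr_fun this x

/-- A field homomorphism `g` passes through the rational expression defining `Φ`. Right
multiplication thus acts on images by a formula independent of `g`, which turns powers into
iterates. -/
theorem image_mul_phi (M : Model) (g : RatXY ≃ₐ[ℚ] RatXY) :
    image (g * M.phi) = phiMap M.1 (image g) := by
  simp only [image, phiMap, AlgEquiv.mul_apply, M.phi_X, M.phi_Y, map_mul, map_inv₀, map_div₀,
    B_eq_lineSum M.2.small, map_lineSum]

theorem image_mul_psi (M : Model) (g : RatXY ≃ₐ[ℚ] RatXY) :
    image (g * M.psi) = psiMap M.1 (image g) := by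
  simp only [image, psiMap, AlgEquiv.mul_apply, M.psi_X, M.psi_Y, map_mul, map_inv₀, map_div₀,
    A_eq_lineSum M.2.small, map_lineSum]

theorem image_pow (M : Model) (n : ℕ) :
    image ((M.phi * M.psi) ^ n) = (thetaMap M.1)^[n] (X, Y) := by
  induction n with
  | zero => rfl
  | succ n ih =>
    rw [pow_succ, ← mul_assoc, image_mul_psi, image_mul_phi, ih, Function.iterate_succ_apply',
      thetaMap]

theorem pow_eq_one_iff (M : Model) (n : ℕ) :
    (M.phi * M.psi) ^ n = 1 ↔ (thetaMap M.1)^[n] (X, Y) = (X, Y) := by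
  rw [← image_pow, ← image_one, image_injective.eq_iff]

end WalkGroup

theorem IsModel.lineNonempty {S : Finset Step} (h : IsModel S) :
    (LineNonempty (col S (-1)) ∧ LineNonempty (col S 1)) ∧
      LineNonempty (row S (-1)) ∧ LineNonempty (row S 1) := by
  have key : ∀ s ∈ S, -1 ≤ s.1 ∧ s.1 ≤ 1 ∧ -1 ≤ s.2 ∧ s.2 ≤ 1 := fun s hs =>
    bounds_of_mem_smallSteps s (h.small hs)
  have hc : ∀ s ∈ S, LineNonempty (col S s.1) := by
    rintro ⟨i, j⟩ hs
    have := key _ hs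
    have hj : j = -1 ∨ j = 0 ∨ j = 1 := by simp only at this; omega
    rcases hj with rfl | rfl | rfl <;> simp [LineNonempty, col, hs]
  have hr : ∀ s ∈ S, LineNonempty (row S s.2) := by
    rintro ⟨i, j⟩ hs
    have := key _ hs
    have hj : i = -1 ∨ i = 0 ∨ i = 1 := by simp only at this; omega
    rcases hj with rfl | rfl | rfl <;> simp [LineNonempty, row, hs]
  obtain ⟨⟨a, ha, ha'⟩, ⟨b, hb, hb'⟩, ⟨c, hc1, hc'⟩, ⟨d, hd, hd'⟩⟩ := h.signs
  refine ⟨⟨?_, ?_⟩, ?_, ?_⟩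
  · have := hc b hb
    rwa [show b.1 = -1 by have := key b hb; omega] at this
  · have := hc a ha
    rwa [show a.1 = 1 by have := key a ha; omega] at this
  · have := hr d hd
    rwa [show d.2 = -1 by have := key d hd; omega] at this
  · have := hr c hc1
    rwa [show c.2 = 1 by have := key c hc1; omega] at this

/-! ### Specialization at rational points -/

namespace WalkGroup

/-- The rational function `f` is defined at the point `P`, with value `c`. -/
def HasValue (P : ℚ × ℚ) (f : RatXY) (c : ℚ) : Prop :=
  ∃ p q : MvPolynomial (Fin 2) ℚ, MvPolynomial.eval ![P.1, P.2] q ≠ 0 ∧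
    f * algebraMap _ RatXY q = algebraMap _ RatXY p ∧
    c * MvPolynomial.eval ![P.1, P.2] q = MvPolynomial.eval ![P.1, P.2] p

namespace HasValue

variable {P : ℚ × ℚ} {f g : RatXY} {c d : ℚ}

theorem unique (hf : HasValue P f c) (hf' : HasValue P f d) : c = d := by
  obtain ⟨p, q, hq, h1, h2⟩ := hf
  obtain ⟨p', q', hq', h1', h2'⟩ := hf'
  have h : p * q' = p' * q := by
    apply IsFractionRing.injective (MvPolynomial (Fin 2) ℚ) RatXY
    rw [map_mul, map_mul, ← h1, ← h1']
    ring
  have h' := congrArg (MvPolynomial.eval ![P.1, P.2]) h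
  rw [map_mul, map_mul, ← h2, ← h2'] at h'
  have : (c - d) * (MvPolynomial.eval ![P.1, P.2] q * MvPolynomial.eval ![P.1, P.2] q') = 0 := by
    linear_combination h'
  simpa [hq, hq', sub_eq_zero] using this

theorem algebraMap (p : MvPolynomial (Fin 2) ℚ) :
    HasValue P (algebraMap _ RatXY p) (MvPolynomial.eval ![P.1, P.2] p) :=
  ⟨p, 1, by simp, by simp, by simp⟩

theorem X (P : ℚ × ℚ) : HasValue P X P.1 := by
  simpa [WalkGroup.X] using HasValue.algebraMap (P := P) (MvPolynomial.X 0)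

theorem Y (P : ℚ × ℚ) : HasValue P Y P.2 := by
  simpa [WalkGroup.Y] using HasValue.algebraMap (P := P) (MvPolynomial.X 1)

theorem zero : HasValue P 0 0 := by simpa using HasValue.algebraMap (P := P) 0

theorem one : HasValue P 1 1 := by simpa using HasValue.algebraMap (P := P) 1

theorem add (hf : HasValue P f c) (hg : HasValue P g d) : HasValue P (f + g) (c + d) := by
  obtain ⟨p, q, hq, h1, h2⟩ := hf
  obtain ⟨p', q', hq', h1', h2'⟩ := hg
  refine ⟨p * q' + p' * q, q * q', by simp [hq, hq'], ?_, ?_⟩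
  · simp only [map_mul, map_add, ← h1, ← h1']
    ring
  · simp only [map_mul, map_add, ← h2, ← h2']
    ring

theorem mul (hf : HasValue P f c) (hg : HasValue P g d) : HasValue P (f * g) (c * d) := by
  obtain ⟨p, q, hq, h1, h2⟩ := hf
  obtain ⟨p', q', hq', h1', h2'⟩ := hg
  refine ⟨p * p', q * q', by simp [hq, hq'], ?_, ?_⟩
  · simp only [map_mul, ← h1, ← h1']
    ring
  · simp only [map_mul, ← h2, ← h2']
    ring

theorem inv (hf : HasValue P f c) (hc : c ≠ 0) : HasValue P f⁻¹ c⁻¹ := by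
  obtain ⟨p, q, hq, h1, h2⟩ := hf
  have hp : MvPolynomial.eval ![P.1, P.2] p ≠ 0 := by
    rw [← h2]
    exact mul_ne_zero hc hq
  have hf0 : f ≠ 0 := by
    rintro rfl
    rw [zero_mul, eq_comm, map_eq_zero_iff _ (IsFractionRing.injective _ RatXY)] at h1
    simp [h1] at hp
  refine ⟨q, p, hp, ?_, ?_⟩
  · rw [← h1]
    field_simp
  · rw [← h2]
    field_simp

theorem div (hf : HasValue P f c) (hg : HasValue P g d) (hd : d ≠ 0) :
    HasValue P (f / g) (c / d) := by
  rw [div_eq_mul_inv, div_eq_mul_inv]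
  exact hf.mul (hg.inv hd)

theorem lineSum (p : ℤ → Bool) (hf : HasValue P f c) (hc : c ≠ 0) :
    HasValue P (lineSum p f) (lineSum p c) := by
  refine (HasValue.add ?_ ?_).add ?_
  · split_ifs
    exacts [hf.inv hc, .zero]
  · split_ifs
    exacts [.one, .zero]
  · split_ifs
    exacts [hf, .zero]

end HasValue

theorem lineSum_pos {p : ℤ → Bool} (hp : LineNonempty p) {c : ℚ} (hc : 0 < c) :
    0 < lineSum p c := by
  have := inv_pos.2 hc
  unfold lineSum
  rcases hp with h | h | h <;> simp only [h, if_true] <;> split_ifs <;> positivity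

/-- Both coordinates of `f` take a positive value at `P`. -/
structure HasPosValue (P : ℚ × ℚ) (f : RatXY × RatXY) (c : ℚ × ℚ) : Prop where
  fst : HasValue P f.1 c.1
  snd : HasValue P f.2 c.2
  fst_pos : 0 < c.1
  snd_pos : 0 < c.2

/-- Positivity is the invariant that keeps every denominator non-zero: a non-empty sum of powers of
a positive number is positive. -/
theorem HasPosValue.thetaMap {P : ℚ × ℚ} {f : RatXY × RatXY} {c : ℚ × ℚ} {S : Finset Step}
    (hS : IsModel S) (h : HasPosValue P f c) :
    HasPosValue P (thetaMap S f) (thetaMap S c) := by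
  obtain ⟨⟨h1, h2⟩, h3, h4⟩ := hS.lineNonempty
  have h' : HasPosValue P (phiMap S f) (phiMap S c) :=
    ⟨(h.fst.inv h.fst_pos.ne').mul ((h.snd.lineSum _ h.snd_pos.ne').div
        (h.snd.lineSum _ h.snd_pos.ne') (lineSum_pos h2 h.snd_pos).ne'), h.snd,
      mul_pos (inv_pos.2 h.fst_pos) (div_pos (lineSum_pos h1 h.snd_pos)
        (lineSum_pos h2 h.snd_pos)), h.snd_pos⟩
  exact ⟨h'.fst, (h'.snd.inv h'.snd_pos.ne').mul ((h'.fst.lineSum _ h'.fst_pos.ne').div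
        (h'.fst.lineSum _ h'.fst_pos.ne') (lineSum_pos h4 h'.fst_pos).ne'), h'.fst_pos,
      mul_pos (inv_pos.2 h'.snd_pos) (div_pos (lineSum_pos h3 h'.fst_pos)
        (lineSum_pos h4 h'.fst_pos))⟩

theorem pow_ne_one_of_thetaMap_ne (M : Model) {n : ℕ} {P : ℚ × ℚ} (h1 : 0 < P.1) (h2 : 0 < P.2)
    (h : (thetaMap M.1)^[n] P ≠ P) : (M.phi * M.psi) ^ n ≠ 1 := by
  rw [Ne, pow_eq_one_iff]
  intro h'
  have key : ∀ n, HasPosValue P ((thetaMap M.1)^[n] (X, Y)) ((thetaMap M.1)^[n] P) := by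
    intro n
    induction n with
    | zero => exact ⟨.X P, .Y P, h1, h2⟩
    | succ n ih =>
      rw [Function.iterate_succ_apply', Function.iterate_succ_apply']
      exact ih.thetaMap M.2
  have := key n
  rw [h'] at this
  exact h (Prod.ext (this.fst.unique (.X P)) (this.snd.unique (.Y P)))

end WalkGroup

/-! ### The action on leading exponents -/

/-- The least exponent of a line of steps. -/
def lowExp (p : ℤ → Bool) : ℤ := if p (-1) then -1 else if p 0 then 0 else 1

/-- The largest exponent of a line of steps. -/
def highExp (p : ℤ → Bool) : ℤ := if p 1 then 1 else if p 0 then 0 else -1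

/-- Positivity in the lexicographic order. -/
def LexPos (e : Step) : Prop := 0 < e.1 ∨ e.1 = 0 ∧ 0 < e.2

instance : DecidablePred LexPos := fun e =>
  inferInstanceAs (Decidable (0 < e.1 ∨ e.1 = 0 ∧ 0 < e.2))

/-- The exponent of the leading term of a line sum whose argument has leading exponent `e`. -/
def leadExp (p : ℤ → Bool) (e : Step) : ℤ := if LexPos e then lowExp p else highExp p

/-- The action of `Φ` on leading exponents. -/
def tropPhi (S : Finset Step) (E : Step × Step) : Step × Step :=
  (-E.1 + (leadExp (col S (-1)) E.2 • E.2 - leadExp (col S 1) E.2 • E.2), E.2)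

/-- The action of `Ψ` on leading exponents. -/
def tropPsi (S : Finset Step) (E : Step × Step) : Step × Step :=
  (E.1, -E.2 + (leadExp (row S (-1)) E.1 • E.1 - leadExp (row S 1) E.1 • E.1))

/-- The action of `ΦΨ` on leading exponents. -/
def tropTheta (S : Finset Step) (E : Step × Step) : Step × Step := tropPsi S (tropPhi S E)

namespace WalkGroup

theorem HasLead.mul_isOneUnit {f u : RatXY} {e : Step} (hf : HasLead f e) (hu : ord.IsOneUnit u) :
    HasLead (f * u) e := by
  rw [HasLead, mul_div_right_comm]
  exact AddValuation.IsOneUnit.mul hf hu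

/-- Here `f` has positive order, so the lowest power dominates; factoring it out leaves `1` plus
terms of positive order. -/
theorem HasLead.lineSum_of_lexPos {f : RatXY} {e : Step} (hf : HasLead f e) (he : LexPos e)
    {p : ℤ → Bool} (hp : LineNonempty p) : HasLead (lineSum p f) (lowExp p • e) := by
  have hpos : 0 < ord f := by
    rw [hf.ord_eq, ← WithTop.coe_zero, WithTop.coe_lt_coe]
    exact Prod.Lex.lt_iff.2 (he.imp id fun h => ⟨h.1.symm, h.2⟩)
  have hf0 : f ≠ 0 := by
    rintro rfl
    simpa using hf.ord_eq
  have hmul : 0 < ord (f * f) := by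
    rw [ord.map_mul]
    exact hpos.trans_le (le_add_of_nonneg_left hpos.le)
  have hite : ∀ (b : Bool) {g : RatXY}, 0 < ord g → 0 < ord (if b then g else 0) := by
    rintro (_ | _) g hg
    · simp
    · simpa using hg
  by_cases h1 : p (-1)
  · have h : lineSum p f =
        f⁻¹ * (1 + ((if p 0 then f else 0) + if p 1 then f * f else 0)) := by
      simp only [lineSum, h1, if_true]
      split_ifs <;> field_simp <;> ring
    rw [h, lowExp, if_pos h1, neg_one_smul]
    exact hf.inv.mul_isOneUnit (.one_add (ord.map_lt_add (hite _ hpos) (hite _ hmul)))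
  · by_cases h0 : p 0
    · have h : lineSum p f = 1 * (1 + if p 1 then f else 0) := by
        simp [lineSum, h1, h0]
      rw [h, lowExp, if_neg h1, if_pos h0, zero_smul]
      exact HasLead.one.mul_isOneUnit (.one_add (hite _ hpos))
    · have h2 : p 1 := by simpa [LineNonempty, h1, h0] using hp
      have h : lineSum p f = f := by simp [lineSum, h1, h0, h2]
      rw [h, lowExp, if_neg h1, if_neg h0, one_smul]
      exact hf

theorem HasLead.lineSum {f : RatXY} {e : Step} (hf : HasLead f e) (he : e ≠ 0)
    {p : ℤ → Bool} (hp : LineNonempty p) : HasLead (lineSum p f) (leadExp p e • e) := by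
  by_cases h : LexPos e
  · rw [leadExp, if_pos h]
    exact hf.lineSum_of_lexPos h hp
  · have h' : LexPos (-e) := by
      unfold LexPos at *
      have : ¬ (e.1 = 0 ∧ e.2 = 0) := fun h => he (Prod.ext h.1 h.2)
      simp only [Prod.fst_neg, Prod.snd_neg]
      omega
    -- When `e` is lexicographically negative, pass to `f⁻¹` and reverse the line; highest and
    -- lowest exponents trade places.
    have h1 : _root_.lineSum p f = _root_.lineSum (fun j => p (-j)) f⁻¹ := by
      simp only [_root_.lineSum, neg_neg, neg_zero, inv_inv]
      ring
    have h2 : highExp p • e = lowExp (fun j => p (-j)) • (-e) := by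
      simp only [highExp, lowExp, neg_neg, neg_zero]
      split_ifs <;> simp
    rw [leadExp, if_neg h, h1, h2]
    refine hf.inv.lineSum_of_lexPos h' ?_
    simp only [LineNonempty, neg_neg, neg_zero] at hp ⊢
    tauto

/-- `f` is a pair of rational functions with leading exponents `E`, a basis of `ℤ²`. -/
structure HasLeads (f : RatXY × RatXY) (E : Step × Step) : Prop where
  fst : HasLead f.1 E.1
  snd : HasLead f.2 E.2
  det : (E.1.1 * E.2.2 - E.1.2 * E.2.1) ^ 2 = 1

variable {f : RatXY × RatXY} {E : Step × Step}

theorem HasLeads.X_Y : HasLeads (X, Y) ((1, 0), (0, 1)) := ⟨.X, .Y, by norm_num⟩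

theorem HasLeads.fst_ne_zero {f : RatXY × RatXY} {E : Step × Step} (h : HasLeads f E) :
    E.1 ≠ 0 := by
  intro h'
  have := h.det
  simp [h'] at this

theorem HasLeads.snd_ne_zero {f : RatXY × RatXY} {E : Step × Step} (h : HasLeads f E) :
    E.2 ≠ 0 := by
  intro h'
  have := h.det
  simp [h'] at this

theorem HasLeads.phiMap (h : HasLeads f E) {S : Finset Step} (hS : IsModel S) :
    HasLeads (phiMap S f) (tropPhi S E) := by
  obtain ⟨⟨h1, h2⟩, -⟩ := hS.lineNonempty
  refine ⟨h.fst.inv.mul ((h.snd.lineSum h.snd_ne_zero h1).div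
    (h.snd.lineSum h.snd_ne_zero h2)), h.snd, ?_⟩
  -- Adding a multiple of one exponent to the other preserves the determinant; negating one changes
  -- its sign, which the square absorbs. A non-zero determinant keeps both exponents non-zero, as
  -- `HasLead.lineSum` requires.
  rw [← h.det]
  simp only [tropPhi, Prod.fst_add, Prod.snd_add, Prod.fst_neg, Prod.snd_neg, Prod.fst_sub,
    Prod.snd_sub, Prod.smul_fst, Prod.smul_snd, smul_eq_mul]
  ring

theorem HasLeads.psiMap (h : HasLeads f E) {S : Finset Step} (hS : IsModel S) :
    HasLeads (psiMap S f) (tropPsi S E) := by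
  obtain ⟨-, h1, h2⟩ := hS.lineNonempty
  refine ⟨h.fst, h.snd.inv.mul ((h.fst.lineSum h.fst_ne_zero h1).div
    (h.fst.lineSum h.fst_ne_zero h2)), ?_⟩
  rw [← h.det]
  simp only [tropPsi, Prod.fst_add, Prod.snd_add, Prod.fst_neg, Prod.snd_neg, Prod.fst_sub,
    Prod.snd_sub, Prod.smul_fst, Prod.smul_snd, smul_eq_mul]
  ring

theorem hasLeads_pow (M : Model) (n : ℕ) :
    HasLeads (image ((M.phi * M.psi) ^ n))
      ((tropTheta M.1)^[n] ((1, 0), (0, 1))) := by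
  rw [image_pow]
  induction n with
  | zero => exact .X_Y
  | succ n ih =>
    rw [Function.iterate_succ_apply', Function.iterate_succ_apply']
    exact (ih.phiMap M.2).psiMap M.2

/-- If the action on leading exponents has period `m`, then `ΦΨ` has order dividing `m`, or
infinite order. -/
theorem orderOf_eq_zero_of_periodic (M : Model) {m : ℕ}
    (hm : (tropTheta M.1)^[m] ((1, 0), (0, 1)) = ((1, 0), (0, 1)))
    (h : (M.phi * M.psi) ^ m ≠ 1) : orderOf (M.phi * M.psi) = 0 := by
  by_contra h0
  have hl := hasLeads_pow M m
  rw [hm] at hl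
  refine h (eq_one_of_pow_eq_one hl.fst hl.snd (Nat.pos_of_ne_zero h0) ?_)
  rw [← pow_mul, mul_comm, pow_mul, pow_orderOf_eq_one, one_pow]

/-- The step sets `{(-1,1), (1,-1)} ∪ T` with `T` in the half-plane above the second diagonal. -/
def IsSingular (S : Finset Step) : Prop :=
  (-1, 1) ∈ S ∧ (1, -1) ∈ S ∧ ∀ s ∈ S, 0 ≤ s.1 + s.2

instance : DecidablePred IsSingular := fun S =>
  inferInstanceAs (Decidable ((-1, 1) ∈ S ∧ (1, -1) ∈ S ∧ ∀ s ∈ S, 0 ≤ s.1 + s.2))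

theorem IsSingular.lowExp {S : Finset Step} (h : IsSingular S) :
    (lowExp (col S (-1)) = 1 ∧ lowExp (col S 1) = -1) ∧
      lowExp (row S (-1)) = 1 ∧ lowExp (row S 1) = -1 := by
  obtain ⟨h1, h2, h3⟩ := h
  have h4 : ((-1, -1) : Step) ∉ S := fun h => by simpa using h3 _ h
  have h5 : ((-1, 0) : Step) ∉ S := fun h => by simpa using h3 _ h
  have h6 : ((0, -1) : Step) ∉ S := fun h => by simpa using h3 _ h
  simp [_root_.lowExp, col, row, h1, h2, h4, h5, h6]

/-- Applying `Ψ` before `Φ` to exponents keeps them all lexicographically positive, so only lowest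
exponents matter. Each involution then replaces an exponent by its negative plus twice the other
one, which gives an arithmetic progression. -/
theorem hasLeads_pow_of_isSingular (M : Model) (h : IsSingular M.1) (n : ℕ) :
    HasLeads (image ((M.psi * M.phi) ^ n))
      ((2 * (n : ℤ) + 1, -2 * (n : ℤ)), (2 * (n : ℤ), 1 - 2 * (n : ℤ))) := by
  obtain ⟨⟨h1, h2⟩, h3, h4⟩ := h.lowExp
  induction n with
  | zero => exact .X_Y
  | succ n ih =>
    have hpsi := ih.psiMap M.2
    have e1 : tropPsi M.1 (((2 * (n : ℤ) + 1, -2 * (n : ℤ)), (2 * (n : ℤ), 1 - 2 * (n : ℤ))) :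
        Step × Step) =
        ((2 * (n : ℤ) + 1, -2 * (n : ℤ)), (2 * (n : ℤ) + 2, -1 - 2 * (n : ℤ))) := by
      have hpos : LexPos (2 * (n : ℤ) + 1, -2 * (n : ℤ)) := by
        simp only [LexPos]
        omega
      simp only [tropPsi, leadExp, if_pos hpos, h3, h4, Prod.smul_mk, Prod.mk_sub_mk,
        Prod.neg_mk, Prod.mk_add_mk, smul_eq_mul]
      ext <;> simp <;> ring
    rw [e1] at hpsi
    have hphi := hpsi.phiMap M.2
    have e2 : tropPhi M.1 (((2 * (n : ℤ) + 1, -2 * (n : ℤ)), (2 * (n : ℤ) + 2, -1 - 2 * (n : ℤ))) :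
        Step × Step) =
        ((2 * ((n + 1 : ℕ) : ℤ) + 1, -2 * ((n + 1 : ℕ) : ℤ)),
          (2 * ((n + 1 : ℕ) : ℤ), 1 - 2 * ((n + 1 : ℕ) : ℤ))) := by
      have hpos : LexPos (2 * (n : ℤ) + 2, -1 - 2 * (n : ℤ)) := by
        simp only [LexPos]
        omega
      simp only [tropPhi, leadExp, if_pos hpos, h1, h2, Prod.smul_mk, Prod.mk_sub_mk,
        Prod.neg_mk, Prod.mk_add_mk, smul_eq_mul]
      ext <;> simp <;> ring
    rw [e2] at hphi
    rw [pow_succ, ← mul_assoc, image_mul_phi, image_mul_psi]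
    exact hphi

end WalkGroup

namespace Model

open WalkGroup

theorem phi_mul_self (M : Model) : M.phi * M.phi = 1 := by
  refine image_injective ?_
  rw [image_one]
  have h1 : M.phi (M.phi X) = X := (M.phi.symm_apply_apply X)
  have h2 : M.phi (M.phi Y) = Y := (M.phi.symm_apply_apply Y)
  exact Prod.ext h1 h2

theorem psi_mul_self (M : Model) : M.psi * M.psi = 1 := by
  refine image_injective ?_
  rw [image_one]
  have h1 : M.psi (M.psi X) = X := (M.psi.symm_apply_apply X)
  have h2 : M.psi (M.psi Y) = Y := (M.psi.symm_apply_apply Y)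
  exact Prod.ext h1 h2

theorem orderOf_eq_zero_of_isSingular (M : Model) (h : IsSingular M.1) :
    orderOf (M.phi * M.psi) = 0 := by
  -- The progression of exponents is known for `ΨΦ`, which is the inverse of `ΦΨ`.
  have hinv : M.phi * M.psi = (M.psi * M.phi)⁻¹ := by
    rw [mul_inv_rev, inv_eq_of_mul_eq_one_left M.psi_mul_self,
      inv_eq_of_mul_eq_one_left M.phi_mul_self]
  rw [hinv, orderOf_inv, orderOf_eq_zero_iff']
  intro n hn h1
  have h2 := (hasLeads_pow_of_isSingular M h n).fst
  rw [h1, image_one] at h2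
  have := h2.unique .X
  simp only [Prod.mk.injEq] at this
  omega

end Model

/-! ### Groups generated by two involutions -/

section TwoInvolutions

variable {G : Type*} [Group G] {a b : G}

/-- Conjugation by `a` inverts `a * b`. -/
theorem conj_mem_zpowers_mul (ha : a * a = 1) (hb : b * b = 1) {z : G}
    (hz : z ∈ Subgroup.zpowers (a * b)) : a * z * a ∈ Subgroup.zpowers (a * b) := by
  have ha' : a⁻¹ = a := inv_eq_of_mul_eq_one_left ha
  have hb' : b⁻¹ = b := inv_eq_of_mul_eq_one_left hb
  obtain ⟨k, rfl⟩ := Subgroup.mem_zpowers_iff.1 hz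
  have h : a * (a * b) ^ k * a = (a * b) ^ (-k) := by
    calc a * (a * b) ^ k * a = a * (a * b) ^ k * a⁻¹ := by rw [ha']
      _ = (a * (a * b) * a⁻¹) ^ k := (conj_zpow).symm
      _ = ((a * b)⁻¹) ^ k := by
        rw [mul_inv_rev, ha', hb', ← mul_assoc, ha, one_mul]
      _ = (a * b) ^ (-k) := by rw [inv_zpow, zpow_neg]
  rw [h]
  exact Subgroup.zpow_mem_zpowers _ _

/-- If `a` were a power of `a * b`, it would commute with `a * b`, hence with `b`. Then `(a * b) ^ 2
= 1`, so `a` is `1` or `a * b`, forcing `a = 1` or `b = 1`. -/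
theorem notMem_zpowers_mul (ha : a * a = 1) (hb : b * b = 1) (ha1 : a ≠ 1) (hb1 : b ≠ 1) :
    a ∉ Subgroup.zpowers (a * b) := by
  have ha' : a⁻¹ = a := inv_eq_of_mul_eq_one_left ha
  have hb' : b⁻¹ = b := inv_eq_of_mul_eq_one_left hb
  rintro ⟨k, hk⟩
  simp only at hk
  have hc := ((Commute.refl (a * b)).zpow_left k).eq
  rw [hk] at hc
  have hab : b * a = a * b := by
    rw [← mul_assoc, ha, one_mul] at hc
    nth_rewrite 1 [hc]
    rw [mul_assoc, ha, mul_one]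
  have h2 : (a * b) ^ (2 : ℤ) = 1 := by
    rw [zpow_two, mul_assoc, ← mul_assoc b, hab, mul_assoc, hb, mul_one, ha]
  rcases Int.even_or_odd' k with ⟨c, rfl | rfl⟩
  · rw [zpow_mul, h2, one_zpow] at hk
    exact ha1 hk.symm
  · rw [zpow_add, zpow_mul, h2, one_zpow, one_mul, zpow_one] at hk
    exact hb1 (mul_eq_left.1 hk)

/-- The group generated by two involutions is dihedral. -/
theorem Subgroup.card_closure_pair_of_involutions (ha : a * a = 1) (hb : b * b = 1) (ha1 : a ≠ 1)
    (hb1 : b ≠ 1) : Nat.card (Subgroup.closure {a, b}) = 2 * orderOf (a * b) := by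
  have hA : a ∈ Subgroup.closure {a, b} := Subgroup.subset_closure (by simp)
  have hB : b ∈ Subgroup.closure {a, b} := Subgroup.subset_closure (by simp)
  have hle : Subgroup.zpowers (a * b) ≤ Subgroup.closure {a, b} := by
    rw [Subgroup.zpowers_le]
    exact mul_mem hA hB
  have haa : ∀ x, x * a * a = x := fun x => by rw [mul_assoc, ha, mul_one]
  -- The rotations `zpowers (a * b)` and their translate by `a` exhaust the group; with
  -- `notMem_zpowers_mul` this gives index `2`.
  have key : ∀ g ∈ Subgroup.closure {a, b},
      g ∈ Subgroup.zpowers (a * b) ∨ g * a ∈ Subgroup.zpowers (a * b) := by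
    intro g hg
    induction hg using Subgroup.closure_induction with
    | mem x hx =>
      right
      rcases hx with rfl | rfl
      · rw [ha]
        exact one_mem _
      · have := inv_mem (Subgroup.mem_zpowers (a * x))
        rwa [mul_inv_rev, inv_eq_of_mul_eq_one_left ha, inv_eq_of_mul_eq_one_left hb] at this
    | one => exact .inl (one_mem _)
    | mul x y _ _ hx hy =>
      rcases hx with hx | hx <;> rcases hy with hy | hy
      · exact .inl (mul_mem hx hy)
      · right
        rw [mul_assoc]
        exact mul_mem hx hy
      · right
        have := mul_mem hx (conj_mem_zpowers_mul ha hb hy)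
        rwa [← mul_assoc, ← mul_assoc, haa] at this
      · left
        have := mul_mem hx (conj_mem_zpowers_mul ha hb hy)
        rwa [← mul_assoc, ← mul_assoc, ← mul_assoc, haa, haa] at this
    | inv x _ hx =>
      rcases hx with hx | hx
      · exact .inl (inv_mem hx)
      · right
        have := conj_mem_zpowers_mul ha hb (inv_mem hx)
        rwa [mul_inv_rev, ← mul_assoc, mul_inv_cancel, one_mul] at this
  have hindex : ((Subgroup.zpowers (a * b)).subgroupOf (Subgroup.closure {a, b})).index = 2 := by
    rw [Subgroup.index_eq_two_iff]
    refine ⟨⟨a, hA⟩, fun g => ?_⟩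
    simp only [Subgroup.mem_subgroupOf, Subgroup.coe_mul]
    rcases key g g.2 with h | h
    · refine .inr ⟨h, fun h' => notMem_zpowers_mul ha hb ha1 hb1 ?_⟩
      simpa using mul_mem (inv_mem h) h'
    · refine .inl ⟨h, fun h' => notMem_zpowers_mul ha hb ha1 hb1 ?_⟩
      simpa using mul_mem (inv_mem h') h
  rw [← Subgroup.card_mul_index
    ((Subgroup.zpowers (a * b)).subgroupOf (Subgroup.closure {a, b})), hindex,
    Nat.card_congr (Subgroup.subgroupOfEquivOfLe hle).toEquiv, Nat.card_zpowers, mul_comm]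

end TwoInvolutions

namespace Model

open WalkGroup

/-- The leading exponent of `Φ(x)` has abscissa `-1`, that of `x` has abscissa `1`. -/
theorem phi_ne_one (M : Model) : M.phi ≠ 1 := by
  intro h
  have h0 := (HasLeads.X_Y.phiMap M.2).fst
  rw [← image_one, ← image_mul_phi, h, one_mul, image_one] at h0
  have := congrArg Prod.fst (h0.unique .X)
  simp [tropPhi] at this

theorem psi_ne_one (M : Model) : M.psi ≠ 1 := by
  intro h
  have h0 := (HasLeads.X_Y.psiMap M.2).snd
  rw [← image_one, ← image_mul_psi, h, one_mul, image_one] at h0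
  have := congrArg Prod.snd (h0.unique .Y)
  simp [tropPsi] at this

theorem card_group (M : Model) : Nat.card M.group = 2 * orderOf (M.phi * M.psi) :=
  Subgroup.card_closure_pair_of_involutions M.phi_mul_self M.psi_mul_self M.phi_ne_one
    M.psi_ne_one

end Model

/-! ### Monomial and symmetric models -/

/-- The exponents of two lines of steps differ by a shift. -/
def IsShift (p q : ℤ → Bool) : Prop :=
  lowExp p - lowExp q = highExp p - highExp q ∧ (highExp p = lowExp p + 2 → p 0 = q 0)

instance (p q : ℤ → Bool) : Decidable (IsShift p q) :=
  inferInstanceAs (Decidable (_ ∧ (_ → _)))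

/-- Both `Φ` and `Ψ` are monomial transformations. -/
def IsMonomial (S : Finset Step) : Prop :=
  IsShift (col S (-1)) (col S 1) ∧ IsShift (row S (-1)) (row S 1)

instance : DecidablePred IsMonomial := fun _ => inferInstanceAs (Decidable (_ ∧ _))

/-- The exponent `e` is arbitrary: for shifted lines, lowest and highest exponents differ by the
same amount, so both branches of `leadExp` give the same difference. -/
theorem IsShift.lineSum {F : Type*} [Field F] {p q : ℤ → Bool} (h : IsShift p q)
    (hp : LineNonempty p) (hq : LineNonempty q) {b : F} (hb : b ≠ 0) (e : Step) :
    lineSum p b = b ^ (leadExp p e - leadExp q e) * lineSum q b := by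
  have he : leadExp p e - leadExp q e = lowExp p - lowExp q := by
    unfold leadExp
    split_ifs
    exacts [rfl, h.1.symm]
  rw [he]
  simp only [IsShift, LineNonempty, lowExp, highExp, _root_.lineSum] at *
  generalize p (-1) = p₁ at *
  generalize p 0 = p₂ at *
  generalize p 1 = p₃ at *
  generalize q (-1) = q₁ at *
  generalize q 0 = q₂ at *
  generalize q 1 = q₃ at *
  revert h hp hq
  clear he
  cases p₁ <;> cases p₂ <;> cases p₃ <;> cases q₁ <;> cases q₂ <;> cases q₃ <;>
    intro h hp hq <;> simp at h hp hq <;> simp <;> field_simp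

theorem lineSum_inv {F : Type*} [Field F] {p : ℤ → Bool} (h : p (-1) = p 1) (b : F) :
    lineSum p b⁻¹ = lineSum p b := by
  simp only [lineSum, h, inv_inv]
  split_ifs <;> ring

namespace WalkGroup

theorem HasLead.ne_zero {f : RatXY} {e : Step} (h : HasLead f e) : f ≠ 0 := by
  rintro rfl
  simpa using h.ord_eq

theorem mon_zsmul (n : ℤ) (e : Step) : mon (n • e) = mon e ^ n := by
  simp only [mon, Prod.smul_fst, Prod.smul_snd, smul_eq_mul, mul_zpow, ← zpow_mul]
  rw [mul_comm n, mul_comm n]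

theorem lineSum_mon_div {p q : ℤ → Bool} (h : IsShift p q) (hp : LineNonempty p)
    (hq : LineNonempty q) {e : Step} (he : e ≠ 0) :
    lineSum p (mon e) / lineSum q (mon e) = mon (leadExp p e • e - leadExp q e • e) := by
  rw [h.lineSum hp hq (mon_ne_zero e) e, mul_div_assoc,
    div_self ((HasLead.mon e).lineSum he hq).ne_zero, mul_one, ← sub_smul, mon_zsmul]

/-- A pair of monomials. -/
noncomputable def monPair (E : Step × Step) : RatXY × RatXY := (mon E.1, mon E.2)

theorem monPair_X_Y : monPair ((1, 0), (0, 1)) = (X, Y) := by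
  simp [monPair, mon]

theorem phiMap_monPair {S : Finset Step} (hS : IsModel S) (h : IsMonomial S) {E : Step × Step}
    (hE : E.2 ≠ 0) : phiMap S (monPair E) = monPair (tropPhi S E) := by
  obtain ⟨⟨h1, h2⟩, -⟩ := hS.lineNonempty
  simp only [phiMap, monPair, tropPhi, lineSum_mon_div h.1 h1 h2 hE, mon_add, mon_neg]

theorem psiMap_monPair {S : Finset Step} (hS : IsModel S) (h : IsMonomial S) {E : Step × Step}
    (hE : E.1 ≠ 0) : psiMap S (monPair E) = monPair (tropPsi S E) := by
  obtain ⟨-, h1, h2⟩ := hS.lineNonempty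
  simp only [psiMap, monPair, tropPsi, lineSum_mon_div h.2 h1 h2 hE, mon_add, mon_neg]

/-- In the monomial case leading terms are the whole terms, so a return of the exponents is a return
of the functions. -/
theorem image_pow_of_isMonomial (M : Model) (h : IsMonomial M.1) (n : ℕ) :
    image ((M.phi * M.psi) ^ n) = monPair ((tropTheta M.1)^[n] ((1, 0), (0, 1))) := by
  induction n with
  | zero => rw [pow_zero, image_one, Function.iterate_zero_apply, monPair_X_Y]
  | succ n ih =>
    have hl := hasLeads_pow M n
    rw [pow_succ, ← mul_assoc, image_mul_psi, image_mul_phi, ih, Function.iterate_succ_apply',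
      phiMap_monPair M.2 h hl.snd_ne_zero, psiMap_monPair M.2 h (hl.phiMap M.2).fst_ne_zero,
      tropTheta]

theorem pow_ne_one_of_tropTheta_ne (M : Model) {n : ℕ}
    (h : (tropTheta M.1)^[n] ((1, 0), (0, 1)) ≠ ((1, 0), (0, 1))) : (M.phi * M.psi) ^ n ≠ 1 := by
  intro h'
  have hl := hasLeads_pow M n
  rw [h', image_one] at hl
  exact h (Prod.ext (hl.fst.unique .X) (hl.snd.unique .Y))

/-- The step set is symmetric with respect to the vertical axis. -/
def IsVSymm (S : Finset Step) : Prop :=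
  ∀ j ∈ ({-1, 0, 1} : Finset ℤ), (-1, j) ∈ S ↔ (1, j) ∈ S

/-- The step set is symmetric with respect to the horizontal axis. -/
def IsHSymm (S : Finset Step) : Prop :=
  ∀ i ∈ ({-1, 0, 1} : Finset ℤ), (i, -1) ∈ S ↔ (i, 1) ∈ S

instance : DecidablePred IsVSymm := fun S =>
  inferInstanceAs (Decidable (∀ j ∈ ({-1, 0, 1} : Finset ℤ), (-1, j) ∈ S ↔ (1, j) ∈ S))

instance : DecidablePred IsHSymm := fun S =>
  inferInstanceAs (Decidable (∀ i ∈ ({-1, 0, 1} : Finset ℤ), (i, -1) ∈ S ↔ (i, 1) ∈ S))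

theorem image_phi (M : Model) : image M.phi = phiMap M.1 (X, Y) := by
  rw [← image_one, ← image_mul_phi, one_mul]

theorem image_psi (M : Model) : image M.psi = psiMap M.1 (X, Y) := by
  rw [← image_one, ← image_mul_psi, one_mul]

/-- The symmetry gives `B₋₁ = B₁`, so `Φ` only inverts `x`, and `A₋₁`, `A₁` are unchanged under
inverting `x`. -/
theorem commute_of_isVSymm (M : Model) (h : IsVSymm M.1) : M.phi * M.psi = M.psi * M.phi := by
  have hl := HasLeads.X_Y
  have hl' := hl.psiMap M.2
  have hc : ∀ b : RatXY, lineSum (col M.1 (-1)) b = lineSum (col M.1 1) b := fun b => by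
    simp [lineSum, col, h (-1) (by simp), h 0 (by simp), h 1 (by simp)]
  have hr : ∀ (j : ℤ) (a : RatXY), (j = -1 ∨ j = 1) →
      lineSum (row M.1 j) a⁻¹ = lineSum (row M.1 j) a := fun j a hj => by
    have hj' : (-1, j) ∈ M.1 ↔ (1, j) ∈ M.1 := h j (by rcases hj with rfl | rfl <;> simp)
    exact lineSum_inv (decide_eq_decide.2 hj') _
  have hphi : ∀ f : RatXY × RatXY, ∀ E, HasLeads f E → phiMap M.1 f = (f.1⁻¹, f.2) := by
    intro f E hf
    rw [phiMap, hc, div_self (hf.snd.lineSum hf.snd_ne_zero M.2.lineNonempty.1.2).ne_zero,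
      mul_one]
  apply image_injective
  rw [image_mul_psi, image_mul_phi, image_phi, image_psi, hphi _ _ hl, hphi _ _ hl']
  simp only [psiMap, hr (-1) _ (.inl rfl), hr 1 _ (.inr rfl)]

theorem commute_of_isHSymm (M : Model) (h : IsHSymm M.1) : M.phi * M.psi = M.psi * M.phi := by
  have hl := HasLeads.X_Y
  have hl' := hl.phiMap M.2
  have hr : ∀ a : RatXY, lineSum (row M.1 (-1)) a = lineSum (row M.1 1) a := fun a => by
    simp [lineSum, row, h (-1) (by simp), h 0 (by simp), h 1 (by simp)]
  have hc : ∀ (i : ℤ) (b : RatXY), (i = -1 ∨ i = 1) →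
      lineSum (col M.1 i) b⁻¹ = lineSum (col M.1 i) b := fun i b hi => by
    have hi' : (i, -1) ∈ M.1 ↔ (i, 1) ∈ M.1 := h i (by rcases hi with rfl | rfl <;> simp)
    exact lineSum_inv (decide_eq_decide.2 hi') _
  have hpsi : ∀ f : RatXY × RatXY, ∀ E, HasLeads f E → psiMap M.1 f = (f.1, f.2⁻¹) := by
    intro f E hf
    rw [psiMap, hr, div_self (hf.fst.lineSum hf.fst_ne_zero M.2.lineNonempty.2.2).ne_zero,
      mul_one]
  apply image_injective
  rw [image_mul_psi, image_mul_phi, image_phi, image_psi, hpsi _ _ hl, hpsi _ _ hl']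
  simp only [phiMap, hc (-1) _ (.inl rfl), hc 1 _ (.inr rfl)]

theorem pow_two_eq_one_of_symm (M : Model) (h : IsVSymm M.1 ∨ IsHSymm M.1) :
    (M.phi * M.psi) ^ 2 = 1 := by
  have hc : M.phi * M.psi = M.psi * M.phi := h.elim (commute_of_isVSymm M) (commute_of_isHSymm M)
  calc (M.phi * M.psi) ^ 2 = M.phi * (M.psi * M.phi) * M.psi := by simp only [pow_two, mul_assoc]
    _ = (M.phi * M.phi) * (M.psi * M.psi) := by
      rw [← hc]
      simp only [mul_assoc]
    _ = 1 := by rw [M.phi_mul_self, M.psi_mul_self, mul_one]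

end WalkGroup

/-! ### Deciding which step sets are models -/

theorem not_xForcesY_iff {S : Finset Step} (hS : S ⊆ smallSteps) (h : HasAllSigns S) :
    ¬ XForcesY S ↔ ∃ s ∈ S, s.2 < s.1 := by
  constructor
  · intro hf
    by_contra! hle
    refine hf fun w hw h0 => h0.trans ?_
    clear h0
    induction w with
    | nil => simp
    | cons t w ih =>
      have h1 := hle t (hw t (by simp))
      have h2 := ih fun s hs => hw s (by simp [hs])
      simp only [List.sum_cons, Prod.fst_add, Prod.snd_add]
      omega
  · rintro ⟨s, hs, hlt⟩ hf
    obtain ⟨t, ht, htn⟩ := h.y_neg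
    have b1 := bounds_of_mem_smallSteps s (hS hs)
    have b2 := bounds_of_mem_smallSteps t (hS ht)
    -- A step below the diagonal is `(1,0)`, `(1,-1)` or `(0,-1)`. The last two already violate the
    -- implication; after `(1,0)`, a `y`-negative step does so.
    have h1 := hf [s] (by simpa using hs)
    have h2 := hf [s, t] (by simp [hs, ht])
    simp only [List.sum_cons, List.sum_nil, Prod.fst_add, Prod.snd_add, add_zero] at h1 h2
    omega

/-- Transported from `not_xForcesY_iff` by swapping coordinates along every walk. -/
theorem not_yForcesX_iff {S : Finset Step} (hS : S ⊆ smallSteps) (h : HasAllSigns S) :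
    ¬ YForcesX S ↔ ∃ s ∈ S, s.1 < s.2 := by
  have hsum : ∀ w : List Step, (w.map Prod.swap).sum = w.sum.swap := fun w => by
    induction w with
    | nil => rfl
    | cons s w ih => simp [ih]
  have hmem : ∀ s, s ∈ reflectDiag S ↔ s.swap ∈ S := fun s => by
    simp only [reflectDiag, Finset.mem_image]
    constructor
    · rintro ⟨t, ht, rfl⟩
      simpa using ht
    · exact fun hs => ⟨_, hs, by simp⟩
  have h1 : YForcesX S ↔ XForcesY (reflectDiag S) := by
    constructor
    · intro hf w hw h0
      have := hf (w.map Prod.swap) (by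
        intro s hs
        obtain ⟨t, ht, rfl⟩ := List.mem_map.1 hs
        exact (hmem t).1 (hw t ht))
      rw [hsum] at this
      exact this h0
    · intro hf w hw h0
      have := hf (w.map Prod.swap) (by
        intro s hs
        obtain ⟨t, ht, rfl⟩ := List.mem_map.1 hs
        exact (hmem _).2 (by simpa using hw t ht))
      rw [hsum] at this
      exact this h0
  have hS' : reflectDiag S ⊆ smallSteps := by
    intro s hs
    have key : ∀ s ∈ smallSteps, s.swap ∈ smallSteps := by decide
    simpa using key _ (hS ((hmem s).1 hs))
  have ex : ∀ P : Step → Prop, (∃ s ∈ reflectDiag S, P s) ↔ ∃ s ∈ S, P s.swap := fun P => by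
    simp only [reflectDiag, Finset.mem_image, exists_exists_and_eq_and]
  rw [h1, not_xForcesY_iff hS' ⟨(ex _).2 h.y_pos, (ex _).2 h.y_neg, (ex _).2 h.x_pos,
    (ex _).2 h.x_neg⟩, ex]
  rfl

/-- A decidable characterization of models. -/
def ModelTest (S : Finset Step) : Prop :=
  ((∃ s ∈ S, 0 < s.1) ∧ (∃ s ∈ S, s.1 < 0) ∧ (∃ s ∈ S, 0 < s.2) ∧ ∃ s ∈ S, s.2 < 0) ∧
    (∃ s ∈ S, 0 ≤ s.1 ∧ 0 ≤ s.2) ∧ (∃ s ∈ S, s.2 < s.1) ∧ ∃ s ∈ S, s.1 < s.2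

instance : DecidablePred ModelTest := fun _ => inferInstanceAs (Decidable (_ ∧ _))

theorem isModel_iff {S : Finset Step} : IsModel S ↔ S ∈ smallSteps.powerset ∧ ModelTest S := by
  rw [Finset.mem_powerset]
  constructor
  · intro h
    exact ⟨h.small, ⟨h.signs.x_pos, h.signs.x_neg, h.signs.y_pos, h.signs.y_neg⟩, h.nonneg_step,
      (not_xForcesY_iff h.small h.signs).1 h.not_x_forces_y,
      (not_yForcesX_iff h.small h.signs).1 h.not_y_forces_x⟩
  · rintro ⟨h, ⟨h1, h2, h3, h4⟩, h5, h6, h7⟩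
    exact ⟨h, ⟨h1, h2, h3, h4⟩, h5, (not_xForcesY_iff h ⟨h1, h2, h3, h4⟩).2 h6,
      (not_yForcesX_iff h ⟨h1, h2, h3, h4⟩).2 h7⟩

/-! ### The order of `ΦΨ` for every model -/

namespace WalkGroup

/-- The order of `ΦΨ`, with the value `0` if it is infinite. -/
def thetaOrder (S : Finset Step) : ℕ :=
  if IsVSymm S ∨ IsHSymm S then 2
  else if IsMonomial S ∧ (tropTheta S)^[3] ((1, 0), (0, 1)) = ((1, 0), (0, 1)) then 3
  else if IsMonomial S ∧ (tropTheta S)^[4] ((1, 0), (0, 1)) = ((1, 0), (0, 1)) then 4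
  else 0

/-- Supplies minimality for the finite orders: no smaller positive power acts trivially even on
leading exponents. -/
theorem tropTheta_iterate_ne : ∀ S ∈ smallSteps.powerset, ModelTest S →
    ∀ k < thetaOrder S, 0 < k → (tropTheta S)^[k] ((1, 0), (0, 1)) ≠ ((1, 0), (0, 1)) := by
  decide +kernel

/-- Outside the singular models a period `m ≤ 8` of the exponents suffices. The value `m = 0` is
excluded by the second condition, since the zeroth iterate fixes the point. Positivity of `(2,3)`
makes the specialization legitimate. -/
theorem exists_period : ∀ S ∈ smallSteps.powerset, ModelTest S → thetaOrder S = 0 →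
    IsSingular S ∨ ∃ m ∈ Finset.range 9,
      (tropTheta S)^[m] ((1, 0), (0, 1)) = ((1, 0), (0, 1)) ∧
        (thetaMap S)^[m] ((2, 3) : ℚ × ℚ) ≠ (2, 3) := by
  decide +kernel

theorem orderOf_eq_thetaOrder (M : Model) : orderOf (M.phi * M.psi) = thetaOrder M.1 := by
  obtain ⟨hS, hM⟩ := isModel_iff.1 M.2
  rcases Nat.eq_zero_or_pos (thetaOrder M.1) with h0 | hpos
  · rw [h0]
    rcases exists_period _ hS hM h0 with h | ⟨m, -, h1, h2⟩
    · exact M.orderOf_eq_zero_of_isSingular h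
    · exact orderOf_eq_zero_of_periodic M h1
        (pow_ne_one_of_thetaMap_ne M (by norm_num) (by norm_num) h2)
  · rw [orderOf_eq_iff hpos]
    refine ⟨?_, fun k hk hk0 =>
      pow_ne_one_of_tropTheta_ne M (tropTheta_iterate_ne _ hS hM k hk hk0)⟩
    have key : ∀ n, IsMonomial M.1 ∧ (tropTheta M.1)^[n] ((1, 0), (0, 1)) = ((1, 0), (0, 1)) →
        (M.phi * M.psi) ^ n = 1 := fun n h => image_injective <| by
      rw [image_pow_of_isMonomial M h.1, h.2, monPair_X_Y, image_one]
    unfold thetaOrder at hpos ⊢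
    split_ifs at hpos ⊢ with h1 h2 h3
    · exact pow_two_eq_one_of_symm M h1
    · exact key 3 h2
    · exact key 4 h3
    · exact absurd hpos (lt_irrefl 0)

end WalkGroup

namespace Model

open WalkGroup

/-- The conventions agree in the infinite case: `orderOf` and `Nat.card` are both `0` there. -/
theorem card_group_eq (M : Model) : Nat.card M.group = 2 * thetaOrder M.1 := by
  rw [M.card_group, orderOf_eq_thetaOrder]

theorem finite_group_iff (M : Model) : Finite M.group ↔ thetaOrder M.1 ≠ 0 := by
  constructor
  · intro h
    have := Nat.card_pos (α := M.group)
    rw [card_group_eq] at this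
    omega
  · intro h
    refine Nat.finite_of_card_ne_zero ?_
    rw [card_group_eq]
    omega

end Model

/-! ### Counting classes by canonical representatives -/

/-- An injective numbering of the sets of small steps. -/
def stepCode (S : Finset Step) : ℕ :=
  ∑ s ∈ S, 2 ^ (3 * s.1 + s.2 + 4).toNat

/-- The representative of a class of models with the smaller code. -/
def IsCanonical (S : Finset Step) : Prop := stepCode S ≤ stepCode (reflectDiag S)

instance : DecidablePred IsCanonical := fun _ => inferInstanceAs (Decidable (_ ≤ _))

theorem eq_reflectDiag_of_stepCode_eq : ∀ S ∈ smallSteps.powerset,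
    stepCode S = stepCode (reflectDiag S) → S = reflectDiag S := by
  decide +kernel

theorem isModel_reflectDiag {S : Finset Step} (h : IsModel S) : IsModel (reflectDiag S) := by
  have key : ∀ S ∈ smallSteps.powerset, ModelTest S →
      reflectDiag S ∈ smallSteps.powerset ∧ ModelTest (reflectDiag S) := by
    decide +kernel
  obtain ⟨h1, h2⟩ := isModel_iff.1 h
  exact isModel_iff.2 (key S h1 h2)

theorem Model.toClass_eq_iff {M N : Model} :
    M.toClass = N.toClass ↔ N.1 = M.1 ∨ N.1 = reflectDiag M.1 :=
  Quotient.eq (r := modelSetoid)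

/-- Classes of models are counted by their canonical representatives. -/
theorem ncard_setOf_modelClass {P : ModelClass → Prop} (Q : Finset Step → Prop) [DecidablePred Q]
    (h : ∀ M : Model, P M.toClass ↔ Q M.1) :
    {c | P c}.ncard =
      (smallSteps.powerset.filter fun S => ModelTest S ∧ IsCanonical S ∧ Q S).card := by
  have h1 : {c | P c} = Model.toClass '' {M : Model | IsCanonical M.1 ∧ Q M.1} := by
    ext c
    simp only [Set.mem_ofPred_eq, Set.mem_image]
    constructor
    · induction c using Quotient.inductionOn with | h M =>
      intro hM
      change P M.toClass at hM
      rcases le_total (stepCode M.1) (stepCode (reflectDiag M.1)) with hc | hc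
      · exact ⟨M, ⟨hc, (h M).1 hM⟩, rfl⟩
      · have hN : Model.toClass ⟨_, isModel_reflectDiag M.2⟩ = M.toClass :=
          (Model.toClass_eq_iff.2 (.inr rfl)).symm
        refine ⟨⟨_, isModel_reflectDiag M.2⟩, ⟨?_, (h _).1 (by rwa [hN])⟩, hN⟩
        rwa [IsCanonical, reflectDiag_reflectDiag]
    · rintro ⟨M, ⟨-, hM⟩, rfl⟩
      exact (h M).2 hM
  have h2 : Set.InjOn Model.toClass {M : Model | IsCanonical M.1 ∧ Q M.1} := by
    rintro M ⟨hM, -⟩ N ⟨hN, -⟩ hMN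
    rcases Model.toClass_eq_iff.1 hMN with he | he
    · exact Subtype.ext he.symm
    · rw [IsCanonical, he, reflectDiag_reflectDiag] at hN
      refine Subtype.ext ?_
      rw [he]
      -- Two canonical reflections of each other have equal codes, which forces the set to be its
      -- own reflection.
      exact eq_reflectDiag_of_stepCode_eq _ (isModel_iff.1 M.2).1 (le_antisymm hM hN)
  have h3 : Function.Injective fun M : Model => M.1 := Subtype.val_injective
  rw [h1, h2.ncard_image, ← Set.ncard_image_of_injective _ h3, ← Set.ncard_coe_finset]
  congr 1
  ext S
  simp only [Set.mem_image, Set.mem_ofPred_eq, Finset.coe_filter]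
  constructor
  · rintro ⟨M, hM, rfl⟩
    have := isModel_iff.1 M.2
    exact ⟨this.1, this.2, hM⟩
  · rintro ⟨h1, h2, h3⟩
    exact ⟨⟨S, isModel_iff.2 ⟨h1, h2⟩⟩, h3, rfl⟩

theorem thetaOrder_reflectDiag (M : Model) :
    WalkGroup.thetaOrder (reflectDiag M.1) = WalkGroup.thetaOrder M.1 := by
  have key : ∀ S ∈ smallSteps.powerset, ModelTest S →
      WalkGroup.thetaOrder (reflectDiag S) = WalkGroup.thetaOrder S := by
    decide +kernel
  obtain ⟨h1, h2⟩ := isModel_iff.1 M.2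
  exact key _ h1 h2

/-- Invariance of `thetaOrder` under the diagonal reflection makes the choice of representative
irrelevant. -/
theorem forall_toClass_eq_iff {P : Model → Prop} {Q : ℕ → Prop}
    (h : ∀ M : Model, P M ↔ Q (WalkGroup.thetaOrder M.1)) (M : Model) :
    (∀ N : Model, N.toClass = M.toClass → P N) ↔ Q (WalkGroup.thetaOrder M.1) := by
  constructor
  · exact fun hN => (h M).1 (hN M rfl)
  · intro hQ N hN
    rw [h]
    rcases Model.toClass_eq_iff.1 hN with he | he
    · rwa [← he]
    · rwa [← thetaOrder_reflectDiag N, ← he]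

instance : DecidablePred VerticallySymmetric := fun S =>
  inferInstanceAs (Decidable (S.image (fun s => (-s.1, s.2)) = S))

/-- The other member of the class is the diagonal reflection, so a finite check on `M.1` and its
reflection is enough. -/
theorem exists_verticallySymmetric_iff (M : Model) :
    (∃ N : Model, N.toClass = M.toClass ∧ VerticallySymmetric N.1) ↔
      WalkGroup.thetaOrder M.1 = 2 := by
  have key : ∀ S ∈ smallSteps.powerset, ModelTest S →
      ((VerticallySymmetric S ∨ VerticallySymmetric (reflectDiag S)) ↔
        WalkGroup.thetaOrder S = 2) := by
    decide +kernel
  rw [← key _ (isModel_iff.1 M.2).1 (isModel_iff.1 M.2).2]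
  constructor
  · rintro ⟨N, hN, h⟩
    rcases Model.toClass_eq_iff.1 hN.symm with he | he
    · exact .inl (he ▸ h)
    · exact .inr (he ▸ h)
  · rintro (h | h)
    · exact ⟨M, rfl, h⟩
    · exact ⟨⟨_, isModel_reflectDiag M.2⟩, (Model.toClass_eq_iff.2 (.inr rfl)).symm, h⟩

theorem mainTheorem1 :
    -- there are `79` models up to the `x/y` symmetry
    Nat.card ModelClass = 79 ∧
    -- exactly `23` of them have a finite group, the other `56` an infinite one
    {c : ModelClass | ∀ M : Model, M.toClass = c → Finite M.group}.ncard = 23 ∧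
    {c : ModelClass | ∀ M : Model, M.toClass = c → Infinite M.group}.ncard = 56 ∧
    -- exactly `16` have a vertical symmetry, and they are those with a group of order `4`
    {c : ModelClass | ∃ M : Model, M.toClass = c ∧ VerticallySymmetric M.1}.ncard = 16 ∧
    (∀ c : ModelClass, (∃ M : Model, M.toClass = c ∧ VerticallySymmetric M.1) ↔
      ∀ M : Model, M.toClass = c → Nat.card M.group = 4) ∧
    -- exactly `5` have a group of order `6`, and exactly `2` a group of order `8`
    {c : ModelClass | ∀ M : Model, M.toClass = c → Nat.card M.group = 6}.ncard = 5 ∧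
    {c : ModelClass | ∀ M : Model, M.toClass = c → Nat.card M.group = 8}.ncard = 2 := by
  have hcard : ∀ (n : ℕ) (M : Model),
      (∀ N : Model, N.toClass = M.toClass → Nat.card N.group = 2 * n) ↔
        WalkGroup.thetaOrder M.1 = n :=
    fun n => forall_toClass_eq_iff (Q := (· = n)) fun M => by
      rw [M.card_group_eq, Nat.mul_right_inj two_ne_zero]
  refine ⟨?_, ?_, ?_, ?_, ?_, ?_, ?_⟩
  · rw [← Set.ncard_univ, ← Set.ofPred_true,
      ncard_setOf_modelClass (fun _ => True) fun _ => Iff.rfl]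
    decide +kernel
  · rw [ncard_setOf_modelClass (fun S => WalkGroup.thetaOrder S ≠ 0)
      (forall_toClass_eq_iff (Q := (· ≠ 0)) Model.finite_group_iff)]
    decide +kernel
  · rw [ncard_setOf_modelClass (fun S => WalkGroup.thetaOrder S = 0)
      (forall_toClass_eq_iff (Q := (· = 0)) fun M => by
        rw [← not_finite_iff_infinite, M.finite_group_iff, not_not])]
    decide +kernel
  · rw [ncard_setOf_modelClass (fun S => WalkGroup.thetaOrder S = 2) exists_verticallySymmetric_iff]
    decide +kernel
  · intro c
    induction c using Quotient.inductionOn with | h M =>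
    exact (exists_verticallySymmetric_iff M).trans (hcard 2 M).symm
  · rw [ncard_setOf_modelClass (fun S => WalkGroup.thetaOrder S = 3) (hcard 3)]
    decide +kernel
  · rw [ncard_setOf_modelClass (fun S => WalkGroup.thetaOrder S = 4) (hcard 4)]
    decide +kernel
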